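/- Let $n\ge 2$ and, for an open set $\Omega\subset\mathbb R^n$, let $d(x)=\operatorname{dist}(x,\partial\Omega)$ and $\delta(x,z)=\min\{d(x),d(z)\}$. A bounded domain $\Omega\subset\mathbb R^n$ is called a John domain if there are a point $x_0\in\Omega$, positive constants $\lambda,K,C_0$ and, for each $y\in\Omega$, a rectifiable curve $\gamma(\cdot,y):[0,1]\to\Omega$ such that (1) $\gamma(0,y)=y$ and $\gamma(1,y)=x_0$; (2) $d(\gamma(t,y))\ge\lambda t$ for all $t\in[0,1]$; (3) $|\dot\gamma(t,y)|\le K$ (i.e. $\gamma(\cdot,y)$ is Lipschitz with constant $K$); (4) for all $x,y\in\Omega$ and $0<r\le\frac12 d(x)$, the part of the curve $\gamma([0,1],y)$ contained in the ball $B(x,r)$ has length (one-dimensional Hausdorff measure) at most $C_0r$. **Theorem.** Let $\Omega\subset\mathbb R^n$ be a John domain, $s\in(0,1)$, $1<p\le q<\infty$, $a\ge0$, $b\le\frac{(n+a)p}{q}+sp-n$ and, additionally, $q\le\frac{np}{n-sp}$ when $p<\frac ns$. Then there is a constant $C>0$, depending only on $n,\Omega,s,p,q,a,b$, such that for every $f\in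 C^\infty(\Omega)$ $$ \inf_{c\in\mathbb R}\Big(\int_\Omega|f(x)-c|^q\,d(x)^a\,dx\Big)^{1/q} \le C\left[\int_\Omega\int_{|x-z|\le d(x)/2}\frac{|f(z)-f(x)|^p}{|z-x|^{n+sp}}\,\delta(x,z)^b\,dz\,dx\right]^{1/p}, $$ where both sides take values in $[0,\infty]$. -/

import Mathlib

open MeasureTheory
open scoped ENNReal NNReal ContDiff

noncomputable section

namespace FracPoincare

/-- `d(x)`, the distance from `x` to the boundary of `Ω`. -/
def bdist {n : ℕ} (Ω : Set (EuclideanSpace ℝ (Fin n))) (x : EuclideanSpace ℝ (Fin n)) : ℝ :=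
  Metric.infDist x (frontier Ω)

/-- `δ(x, z) = min {d(x), d(z)}`. -/
def bdistMin {n : ℕ} (Ω : Set (EuclideanSpace ℝ (Fin n))) (x z : EuclideanSpace ℝ (Fin n)) : ℝ :=
  min (bdist Ω x) (bdist Ω z)

/-- A John domain: a bounded domain `Ω` with a centre `x₀ ∈ Ω` and a family of curves
`γ(·, y) : [0, 1] → Ω`, `y ∈ Ω`, such that `γ(0, y) = y`, `γ(1, y) = x₀`, `d(γ(t, y)) ≥ lam * t`,
`|γ'(t, y)| ≤ K` (that is, `γ(·, y)` is `K`-Lipschitz, in particular rectifiable), and the part of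
the curve inside a ball `B(x, r)` with `r ≤ d(x) / 2` has length (one-dimensional Hausdorff
measure) at most `C * r`. -/
def IsJohnDomain {n : ℕ} (Ω : Set (EuclideanSpace ℝ (Fin n))) : Prop :=
  IsOpen Ω ∧ IsConnected Ω ∧ Bornology.IsBounded Ω ∧
    ∃ x₀ ∈ Ω, ∃ γ : ℝ → EuclideanSpace ℝ (Fin n) → EuclideanSpace ℝ (Fin n),
      ∃ lam : ℝ, 0 < lam ∧ ∃ K : ℝ≥0, 0 < K ∧ ∃ C : ℝ, 0 < C ∧
        (∀ y ∈ Ω, γ 0 y = y ∧ γ 1 y = x₀) ∧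
        (∀ y ∈ Ω, ∀ t ∈ Set.Icc (0 : ℝ) 1, γ t y ∈ Ω ∧ lam * t ≤ bdist Ω (γ t y)) ∧
        (∀ y ∈ Ω, LipschitzOnWith K (fun t => γ t y) (Set.Icc (0 : ℝ) 1)) ∧
        (∀ x ∈ Ω, ∀ y ∈ Ω, ∀ r : ℝ, 0 < r → r ≤ bdist Ω x / 2 →
          Measure.hausdorffMeasure 1 ((fun t => γ t y) '' Set.Icc (0 : ℝ) 1 ∩ Metric.ball x r)
            ≤ ENNReal.ofReal (C * r))

/-- The measure `d(x)^a dx` on `Ω`. -/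
def weightedMeasure {n : ℕ} (Ω : Set (EuclideanSpace ℝ (Fin n))) (a : ℝ) :
    Measure (EuclideanSpace ℝ (Fin n)) :=
  (volume.restrict Ω).withDensity fun x => ENNReal.ofReal (bdist Ω x ^ a)

/-- The weighted fractional energy
`∫_Ω ∫_{|x - z| ≤ d(x)/2} |f(z) - f(x)|^p / |z - x|^(n + s p) δ(x, z)^b dz dx`, in `[0, ∞]`. -/
def fracEnergy {n : ℕ} (Ω : Set (EuclideanSpace ℝ (Fin n))) (s p b : ℝ)
    (f : EuclideanSpace ℝ (Fin n) → ℝ) : ℝ≥0∞ :=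
  ∫⁻ x in Ω, ∫⁻ z in Metric.closedBall x (bdist Ω x / 2),
    ENNReal.ofReal (|f z - f x| ^ p / ‖z - x‖ ^ ((n : ℝ) + s * p) * bdistMin Ω x z ^ b)

end FracPoincare

end

/-! Put α = n/p - n/q and let E(z) be the unweighted inner integral of the energy (`localEnergy`).
Follow the John curve of y through the points at times θ^j, with balls of radius comparable to θ^j.
The averages of f over these balls telescope from a fixed mean m at x₀ to f(y), and each step is
controlled by E^(1/p) on one ball. So |f(y) - m| is at most a constant times the sum over j of
θ^(j(s-n)) ∫ E(z)^(1/p) dz, over |z - y| ≤ Rθ^j and θ^j ≤ κd(z) (`exists_enorm_sub_le_tsum`).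

Test d^(a/q)|f - m| against h ≥ 0 and exchange the integrals (`lintegral_mul_tsum_scales_le`). This
leaves, for each z, a sum over scales θ^j ≤ κd(z) of θ^(js) times averages of h. These averages are
at most Mh(z), and at most a constant times θ^(-jn/q')‖h‖_{q'}. A Hedberg argument
(`exists_mul_tsum_scales_le`) bounds the sum by d(z)^(s-α) (Mh)^(q'/p') ‖h‖_{q'}^(1-q'/p'), which
requires exactly α ≤ s. Hölder with exponents p, p' and the maximal theorem in L^{q'} give the dual
estimate (`exists_lintegral_mul_enorm_sub_le`), with critical weight exponent p(a/q + s - α).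
Truncated extremal choices of h turn it into the norm bound. -/

namespace FracPoincare

/-! ### Hardy–Littlewood maximal theorem -/

section MaximalFunction

variable {E : Type*} [NormedAddCommGroup E] [MeasurableSpace E] (μ : Measure E)

/-- The Hardy–Littlewood maximal function over a countable family of radii. -/
noncomputable def maximalFn (ρ : ℕ → ℝ) (h : E → ℝ≥0∞) (x : E) : ℝ≥0∞ :=
  ⨆ j, (μ (Metric.closedBall x (ρ j)))⁻¹ * ∫⁻ y in Metric.closedBall x (ρ j), h y ∂μ

lemma maximalFn_le_const (ρ : ℕ → ℝ) {h : E → ℝ≥0∞} {N : ℝ≥0∞} (hN : ∀ x, h x ≤ N) (x : E) :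
    maximalFn μ ρ h x ≤ N := by
  refine iSup_le fun j => ?_
  calc _ ≤ (μ (Metric.closedBall x (ρ j)))⁻¹ * ∫⁻ y in Metric.closedBall x (ρ j), N ∂μ := by
        gcongr; exact hN _
    _ = ((μ (Metric.closedBall x (ρ j)))⁻¹ * μ (Metric.closedBall x (ρ j))) * N := by
        rw [setLIntegral_const]; ring
    _ ≤ 1 * N := by gcongr; exact ENNReal.inv_mul_le_one _
    _ = N := one_mul N

/-- Values of `h` up to `N` add at most `N` to any average. With `N = t / 2` this is the truncation
behind the strong type bound. -/
lemma maximalFn_add_const_le (ρ : ℕ → ℝ) (h : E → ℝ≥0∞) (N : ℝ≥0∞) (x : E) :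
    maximalFn μ ρ h x ≤ maximalFn μ ρ ({y | N < h y}.indicator h) x + N := by
  refine iSup_le fun j => ?_
  set B := Metric.closedBall x (ρ j)
  calc (μ B)⁻¹ * ∫⁻ y in B, h y ∂μ
      ≤ (μ B)⁻¹ * ∫⁻ y in B, ({y | N < h y}.indicator h y + N) ∂μ := by
        gcongr with y
        by_cases hy : N < h y
        · simp [hy]
        · rw [Set.indicator_of_notMem (show y ∉ {y | N < h y} from hy), zero_add]
          exact not_lt.1 hy
    _ = (μ B)⁻¹ * (∫⁻ y in B, {y | N < h y}.indicator h y ∂μ) + ((μ B)⁻¹ * μ B) * N := by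
        rw [lintegral_add_right _ measurable_const, setLIntegral_const]; ring
    _ ≤ maximalFn μ ρ ({y | N < h y}.indicator h) x + 1 * N := by
        gcongr
        · exact le_iSup (fun j => (μ (Metric.closedBall x (ρ j)))⁻¹ *
            ∫⁻ y in Metric.closedBall x (ρ j), {y | N < h y}.indicator h y ∂μ) j
        · exact ENNReal.inv_mul_le_one _
    _ = _ := by rw [one_mul]

variable [NormedSpace ℝ E] [FiniteDimensional ℝ E] [BorelSpace E]

lemma measurable_setLIntegral_closedBall [SFinite μ] {h : E → ℝ≥0∞} (hh : Measurable h) (r : ℝ) :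
    Measurable fun x => ∫⁻ y in Metric.closedBall x r, h y ∂μ := by
  have hset : MeasurableSet {p : E × E | dist p.2 p.1 ≤ r} :=
    (isClosed_le (by fun_prop) continuous_const).measurableSet
  have : (fun x => ∫⁻ y in Metric.closedBall x r, h y ∂μ) =
      fun x => ∫⁻ y, {p : E × E | dist p.2 p.1 ≤ r}.indicator (fun p => h p.2) (x, y) ∂μ := by
    ext x
    rw [← lintegral_indicator Metric.isClosed_closedBall.measurableSet]
    rfl
  rw [this]
  exact Measurable.lintegral_prod_right' ((hh.comp measurable_snd).indicator hset)

variable [μ.IsAddHaarMeasure]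

lemma measurable_maximalFn (ρ : ℕ → ℝ) {h : E → ℝ≥0∞} (hh : Measurable h) :
    Measurable (maximalFn μ ρ h) := by
  refine Measurable.iSup fun j => Measurable.mul ?_ (measurable_setLIntegral_closedBall μ hh _)
  simp_rw [Measure.addHaar_closedBall_center]
  exact measurable_const

/-- The weak type `(1, 1)` estimate for the maximal function. -/
lemma mul_meas_lt_maximalFn_le {ρ : ℕ → ℝ} (hρ : ∀ j, 0 < ρ j) {R : ℝ} (hR : ∀ j, ρ j ≤ R)
    (h : E → ℝ≥0∞) (t : ℝ≥0∞) :
    t * μ {x | t < maximalFn μ ρ h x} ≤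
      ENNReal.ofReal (5 ^ Module.finrank ℝ E) * ∫⁻ y, h y ∂μ := by
  set S := {x | t < maximalFn μ ρ h x}
  -- A radius is chosen for every point; off `S` the index 0 is a dummy.
  have hS : ∀ x : E, ∃ j, x ∈ S → t * μ (Metric.closedBall x (ρ j)) ≤
      ∫⁻ y in Metric.closedBall x (ρ j), h y ∂μ := by
    intro x
    by_cases hx : x ∈ S
    · obtain ⟨j, hj⟩ := lt_iSup_iff.1 (show t < maximalFn μ ρ h x from hx)
      refine ⟨j, fun _ => ?_⟩
      rw [mul_comm, ← div_eq_mul_inv] at hj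
      exact ENNReal.mul_le_of_le_div hj.le
    · exact ⟨0, fun h => absurd h hx⟩
  choose J hJ using hS
  obtain ⟨u, huS, hdisj, hcov⟩ := Vitali.exists_disjoint_subfamily_covering_enlargement_closedBall
    S id (fun x => ρ (J x)) R (fun x _ => hR _) 5 (by norm_num)
  have hu : u.Countable := hdisj.countable_of_nonempty_interior fun x _ =>
    ⟨x, Metric.ball_subset_interior_closedBall (Metric.mem_ball_self (hρ (J x)))⟩
  have hsub : S ⊆ ⋃ b ∈ u, Metric.closedBall b (5 * ρ (J b)) := by
    intro x hx
    obtain ⟨b, hb, hxb⟩ := hcov x hx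
    exact Set.mem_biUnion hb (hxb (Metric.mem_closedBall_self (hρ _).le))
  have : Countable u := hu
  calc t * μ S ≤ t * ∑' b : u, μ (Metric.closedBall (b : E) (5 * ρ (J b))) := by
        gcongr
        exact (measure_mono hsub).trans (measure_biUnion_le μ hu _)
    _ = ENNReal.ofReal (5 ^ Module.finrank ℝ E) *
          ∑' b : u, t * μ (Metric.closedBall (b : E) (ρ (J b))) := by
        rw [← ENNReal.tsum_mul_left, ← ENNReal.tsum_mul_left]
        congr 1 with b
        rw [Measure.addHaar_closedBall_mul μ _ (by norm_num) (hρ _).le,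
          Measure.addHaar_closedBall_center μ (b : E)]
        ring
    _ ≤ ENNReal.ofReal (5 ^ Module.finrank ℝ E) *
          ∑' b : u, ∫⁻ y in Metric.closedBall (b : E) (ρ (J b)), h y ∂μ := by
        gcongr with b
        exact hJ b (huS b.2)
    _ = ENNReal.ofReal (5 ^ Module.finrank ℝ E) *
          ∫⁻ y in ⋃ b ∈ u, Metric.closedBall (b : E) (ρ (J b)), h y ∂μ := by
        rw [lintegral_biUnion hu (fun _ _ => Metric.isClosed_closedBall.measurableSet)]
        exact hdisj
    _ ≤ _ := by gcongr; exact Measure.restrict_le_self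

/-- The strong type `(r, r)` estimate for the maximal function, on bounded functions. -/
lemma exists_lintegral_maximalFn_rpow_le {r : ℝ} (hr : 1 < r) :
    ∃ C : ℝ≥0, ∀ (ρ : ℕ → ℝ) (R : ℝ), (∀ j, 0 < ρ j) → (∀ j, ρ j ≤ R) → ∀ h : E → ℝ≥0∞,
      Measurable h → ∀ N : ℝ≥0, (∀ x, h x ≤ N) →
      ∫⁻ x, maximalFn μ ρ h x ^ r ∂μ ≤ C * ∫⁻ x, h x ^ r ∂μ := by
  set A : ℝ≥0 := (5 ^ Module.finrank ℝ E : ℝ).toNNReal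
  refine ⟨r.toNNReal * (2 * A) * ((r - 1)⁻¹.toNNReal * (2 ^ (r - 1) : ℝ).toNNReal),
    fun ρ R hρ hR h hh N hN => ?_⟩
  have hNt : (N : ℝ≥0∞) ≠ ⊤ := ENNReal.coe_ne_top
  set M := maximalFn μ ρ h
  have hM : Measurable M := measurable_maximalFn μ ρ hh
  have hMt : ∀ x, M x ≠ ⊤ := fun x =>
    ((maximalFn_le_const μ ρ hN x).trans_lt ENNReal.coe_lt_top).ne
  have hht : ∀ x, h x ≠ ⊤ := fun x => ((hN x).trans_lt ENNReal.coe_lt_top).ne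
  -- The weak type bound for the part of `h` above `t / 2` has right side `ν {t < 2h}`. The layer
  -- cake formula for `ν` with exponent `r - 1` then recovers ∫ h^(r-1) h dμ.
  set ν := μ.withDensity h
  have hlevel : ∀ t ∈ Set.Ioi (0 : ℝ), μ {x | t < (M x).toReal} * ENNReal.ofReal (t ^ (r - 1)) ≤
      (2 * A : ℝ≥0) * (ν {x | t < 2 * (h x).toReal} * ENNReal.ofReal (t ^ (r - 1 - 1))) := by
    intro t ht
    have ht0 : (0 : ℝ) < t := ht
    have hset : {x | t < (M x).toReal} ⊆
        {x | ENNReal.ofReal (t / 2) <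
          maximalFn μ ρ ({y | ENNReal.ofReal (t / 2) < h y}.indicator h) x} := by
      intro x hx
      have h1 : ENNReal.ofReal t < M x := (ENNReal.ofReal_lt_iff_lt_toReal ht0.le (hMt x)).2 hx
      have h2 := h1.trans_le (maximalFn_add_const_le μ ρ h (ENNReal.ofReal (t / 2)) x)
      have h3 : ENNReal.ofReal t = ENNReal.ofReal (t / 2) + ENNReal.ofReal (t / 2) := by
        rw [← ENNReal.ofReal_add (by positivity) (by positivity), add_halves]
      rw [h3] at h2
      exact lt_of_add_lt_add_right h2
    have hν : ν {x | t < 2 * (h x).toReal} =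
        ∫⁻ x, {y | ENNReal.ofReal (t / 2) < h y}.indicator h x ∂μ := by
      have hs : {x | t < 2 * (h x).toReal} = {y | ENNReal.ofReal (t / 2) < h y} := by
        ext x
        simp only [Set.mem_ofPred_eq]
        rw [ENNReal.ofReal_lt_iff_lt_toReal (by positivity) (hht x), div_lt_iff₀' (by norm_num)]
      have hm : MeasurableSet {y | ENNReal.ofReal (t / 2) < h y} :=
        measurableSet_lt measurable_const hh
      rw [hs, withDensity_apply _ hm, lintegral_indicator hm]
    have hw := mul_meas_lt_maximalFn_le μ hρ hR
      ({y | ENNReal.ofReal (t / 2) < h y}.indicator h) (ENNReal.ofReal (t / 2))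
    rw [← hν] at hw
    have h3 : ENNReal.ofReal (t ^ (r - 1)) =
        ENNReal.ofReal (t / 2) * (2 * ENNReal.ofReal (t ^ (r - 1 - 1))) := by
      have : (2 : ℝ≥0∞) = ENNReal.ofReal 2 := by simp
      rw [this, ← ENNReal.ofReal_mul (by norm_num), ← ENNReal.ofReal_mul (by positivity)]
      congr 1
      rw [Real.rpow_sub_one ht0.ne' (r - 1)]
      field_simp
    calc _ ≤ μ {x | ENNReal.ofReal (t / 2) <
          maximalFn μ ρ ({y | ENNReal.ofReal (t / 2) < h y}.indicator h) x} *
            (ENNReal.ofReal (t / 2) * (2 * ENNReal.ofReal (t ^ (r - 1 - 1)))) := by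
          rw [h3]; gcongr
      _ = (ENNReal.ofReal (t / 2) * μ {x | ENNReal.ofReal (t / 2) <
          maximalFn μ ρ ({y | ENNReal.ofReal (t / 2) < h y}.indicator h) x}) *
            (2 * ENNReal.ofReal (t ^ (r - 1 - 1))) := by ring
      _ ≤ (A * ν {x | t < 2 * (h x).toReal}) * (2 * ENNReal.ofReal (t ^ (r - 1 - 1))) := by
          exact mul_le_mul_left hw _
      _ = _ := by push_cast; ring
  have hlc := lintegral_rpow_eq_lintegral_meas_lt_mul μ (f := fun x => (M x).toReal)
    (Filter.Eventually.of_forall fun _ => ENNReal.toReal_nonneg) hM.ennreal_toReal.aemeasurable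
    (p := r) (by linarith)
  have hlc' := lintegral_rpow_eq_lintegral_meas_lt_mul ν (f := fun x => 2 * (h x).toReal)
    (Filter.Eventually.of_forall fun _ => by positivity)
    (hh.ennreal_toReal.const_mul 2).aemeasurable (p := r - 1) (by linarith)
  have hleft : ∫⁻ x, M x ^ r ∂μ = ∫⁻ x, ENNReal.ofReal ((M x).toReal ^ r) ∂μ := by
    congr 1 with x
    rw [← ENNReal.ofReal_rpow_of_nonneg ENNReal.toReal_nonneg (by linarith),
      ENNReal.ofReal_toReal (hMt x)]
  have hright : ∫⁻ x, ENNReal.ofReal ((2 * (h x).toReal) ^ (r - 1)) ∂ν =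
      ((2 ^ (r - 1) : ℝ).toNNReal : ℝ≥0∞) * ∫⁻ x, h x ^ r ∂μ := by
    rw [lintegral_withDensity_eq_lintegral_mul₀ hh.aemeasurable (by fun_prop),
      ← lintegral_const_mul _ (by fun_prop)]
    congr 1 with x
    rw [Pi.mul_apply, Real.mul_rpow (by norm_num) ENNReal.toReal_nonneg,
      ENNReal.ofReal_mul (by positivity),
      ← ENNReal.ofReal_rpow_of_nonneg ENNReal.toReal_nonneg (by linarith),
      ENNReal.ofReal_toReal (hht x)]
    have : h x ^ r = h x * h x ^ (r - 1) := by
      nth_rw 2 [← ENNReal.rpow_one (h x)]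
      rw [← ENNReal.rpow_add_of_nonneg _ _ zero_le_one (by linarith)]
      congr 1; ring
    rw [this, ENNReal.ofReal]
    ring
  have hinv : ∫⁻ t in Set.Ioi 0, ν {x | t < 2 * (h x).toReal} * ENNReal.ofReal (t ^ (r - 1 - 1)) =
      ((r - 1)⁻¹.toNNReal : ℝ≥0∞) * ∫⁻ x, ENNReal.ofReal ((2 * (h x).toReal) ^ (r - 1)) ∂ν := by
    rw [hlc', ← mul_assoc]
    change _ = (ENNReal.ofReal (r - 1)⁻¹ * _) * _
    rw [← ENNReal.ofReal_mul (by simpa using hr.le), inv_mul_cancel₀ (by linarith)]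
    simp
  rw [hleft, hlc]
  calc _ ≤ ENNReal.ofReal r * ∫⁻ t in Set.Ioi 0, (2 * A : ℝ≥0) *
        (ν {x | t < 2 * (h x).toReal} * ENNReal.ofReal (t ^ (r - 1 - 1))) := by
        refine mul_le_mul_right ?_ _
        exact setLIntegral_mono' measurableSet_Ioi hlevel
    _ = _ := by
        rw [lintegral_const_mul' _ _ ENNReal.coe_ne_top, hinv, hright, ENNReal.ofReal]
        push_cast
        ring

end MaximalFunction

/-! ### Distance to the boundary -/

section Geometry

variable {n : ℕ} {Ω : Set (EuclideanSpace ℝ (Fin n))}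

lemma bdist_le_add_dist (x z : EuclideanSpace ℝ (Fin n)) :
    bdist Ω x ≤ bdist Ω z + dist x z :=
  Metric.infDist_le_infDist_add_dist

lemma continuous_bdist : Continuous (bdist Ω) := Metric.continuous_infDist_pt _

/-- The ball of radius d(x) about x is connected, meets Ω and misses the frontier, so it cannot
leave Ω. -/
lemma mem_of_dist_lt_bdist (hΩ : IsOpen Ω) {x z : EuclideanSpace ℝ (Fin n)} (hx : x ∈ Ω)
    (hz : dist z x < bdist Ω x) : z ∈ Ω := by
  have hconn : IsPreconnected (Metric.ball x (bdist Ω x)) := (convex_ball _ _).isPreconnected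
  refine hconn.subset_of_closure_inter_subset hΩ
    ⟨x, Metric.mem_ball_self (dist_nonneg.trans_lt hz), hx⟩ (fun a ha => ?_) hz
  by_contra haΩ
  have haf : a ∈ frontier Ω := by rw [hΩ.frontier_eq]; exact ⟨ha.1, haΩ⟩
  have h1 : bdist Ω x ≤ dist x a := Metric.infDist_le_dist_of_mem haf
  have h2 := ha.2
  rw [Metric.mem_ball, dist_comm] at h2
  linarith

end Geometry

/-! ### Jensen's inequality for averages -/

section Averages

/-- Jensen's inequality for the deviation from an average. -/
lemma enorm_sub_setAverage_rpow_le {α : Type*} [MeasurableSpace α] {μ : Measure α} {B : Set α}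
    (hB0 : μ B ≠ 0) (hBt : μ B ≠ ⊤) {f : α → ℝ} (hf : IntegrableOn f B μ) (c : ℝ) {p : ℝ}
    (hp : 1 ≤ p) :
    ‖c - ⨍ w in B, f w ∂μ‖ₑ ^ p ≤ (μ B)⁻¹ * ∫⁻ w in B, ‖c - f w‖ₑ ^ p ∂μ := by
  set P : Measure α := (μ B)⁻¹ • μ.restrict B
  have hP : IsProbabilityMeasure P := ⟨by
    simp only [P, Measure.smul_apply, Measure.restrict_apply_univ, smul_eq_mul]
    exact ENNReal.inv_mul_cancel hB0 hBt⟩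
  have hfP : Integrable f P := hf.smul_measure (ENNReal.inv_ne_top.2 hB0)
  have hav : c - ⨍ w in B, f w ∂μ = ∫ w, (c - f w) ∂P := by
    rw [integral_sub (integrable_const _) hfP, integral_const, probReal_univ, one_smul,
      average, Measure.restrict_apply_univ]
  have hp0 : 0 < p := by linarith
  have h1 : ‖∫ w, (c - f w) ∂P‖ₑ ≤ eLpNorm' (fun w => c - f w) p P := by
    refine (enorm_integral_le_lintegral_enorm _).trans ?_
    have := eLpNorm'_le_eLpNorm'_of_exponent_le (f := fun w => c - f w) zero_lt_one hp P
      (aestronglyMeasurable_const.sub hfP.aestronglyMeasurable)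
    simpa [eLpNorm'] using this
  calc _ ≤ eLpNorm' (fun w => c - f w) p P ^ p := by rw [hav]; gcongr
    _ = ∫⁻ w, ‖c - f w‖ₑ ^ p ∂P := by
        rw [eLpNorm', ← ENNReal.rpow_mul, one_div, inv_mul_cancel₀ hp0.ne', ENNReal.rpow_one]
    _ = _ := by rw [lintegral_smul_measure, smul_eq_mul]

end Averages

/-! ### Chaining along John curves -/

section Chain

variable {n : ℕ}

/-- The inner, unweighted integral of the fractional energy. -/
noncomputable def localEnergy (Ω : Set (EuclideanSpace ℝ (Fin n))) (s p : ℝ)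
    (f : EuclideanSpace ℝ (Fin n) → ℝ) (z : EuclideanSpace ℝ (Fin n)) : ℝ≥0∞ :=
  ∫⁻ w in Metric.closedBall z (bdist Ω z / 2),
    ENNReal.ofReal (|f w - f z| ^ p / ‖w - z‖ ^ ((n : ℝ) + s * p))

/-- The volume of the unit ball. -/
noncomputable def unitBallVolume (n : ℕ) : ℝ :=
  (volume (Metric.ball (0 : EuclideanSpace ℝ (Fin n)) 1)).toReal

lemma unitBallVolume_pos (n : ℕ) : 0 < unitBallVolume n :=
  ENNReal.toReal_pos (Metric.measure_ball_pos _ _ one_pos).ne' measure_ball_lt_top.ne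

lemma volume_closedBall_eq (x : EuclideanSpace ℝ (Fin n)) {r : ℝ} (hr : 0 ≤ r) :
    volume (Metric.closedBall x r) = ENNReal.ofReal (r ^ n * unitBallVolume n) := by
  rw [Measure.addHaar_closedBall volume x hr, finrank_euclideanSpace_fin, ENNReal.ofReal_mul
    (by positivity), unitBallVolume, ENNReal.ofReal_toReal measure_ball_lt_top.ne]

variable {Ω : Set (EuclideanSpace ℝ (Fin n))} {s p : ℝ}

lemma enorm_sub_rpow_le {f : EuclideanSpace ℝ (Fin n) → ℝ} (hs : 0 < s) (hp : 1 < p)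
    {z w : EuclideanSpace ℝ (Fin n)} {ρ : ℝ} (hzw : dist w z ≤ ρ) :
    ‖f z - f w‖ₑ ^ p ≤ ENNReal.ofReal (ρ ^ ((n : ℝ) + s * p)) *
      ENNReal.ofReal (|f w - f z| ^ p / ‖w - z‖ ^ ((n : ℝ) + s * p)) := by
  have hρ : 0 ≤ ρ := dist_nonneg.trans hzw
  rw [← ENNReal.ofReal_mul (by positivity), Real.enorm_eq_ofReal_abs, abs_sub_comm,
    ENNReal.ofReal_rpow_of_nonneg (abs_nonneg _) (by linarith)]
  refine ENNReal.ofReal_le_ofReal ?_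
  rcases eq_or_ne w z with rfl | hne
  · rw [sub_self, abs_zero, Real.zero_rpow (by linarith)]; positivity
  · have h0 : 0 < ‖w - z‖ := norm_pos_iff.2 (sub_ne_zero.2 hne)
    rw [dist_eq_norm] at hzw
    have : ‖w - z‖ ^ ((n : ℝ) + s * p) ≤ ρ ^ ((n : ℝ) + s * p) := by gcongr
    rw [← mul_div_assoc, le_div_iff₀ (by positivity), mul_comm]
    gcongr

/-- Jensen is used twice: with exponent p over the second ball for fixed z, where |w - z| ≤ 4r
inserts the kernel and yields r^s E(z)^(1/p), then with exponent 1 over z in the first ball. Ending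
with exponent 1 keeps the chain sum linear in E^(1/p), as the duality argument needs. -/
lemma exists_edist_setAverage_le (n : ℕ) (hs : 0 < s) (hp : 1 < p) :
    ∃ C : ℝ, 0 < C ∧ ∀ (Ω : Set (EuclideanSpace ℝ (Fin n))) (f : EuclideanSpace ℝ (Fin n) → ℝ),
      ContinuousOn f Ω → ∀ (u v : EuclideanSpace ℝ (Fin n)) (r r' : ℝ), 0 < r → r / 2 ≤ r' →
      Metric.closedBall u r ⊆ Ω → Metric.closedBall v r' ⊆ Ω →
      (∀ z ∈ Metric.closedBall u r, ∀ w ∈ Metric.closedBall v r',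
        dist w z ≤ 4 * r ∧ 4 * r ≤ bdist Ω z / 2) →
      edist (⨍ w in Metric.closedBall u r, f w) (⨍ w in Metric.closedBall v r', f w) ≤
        ENNReal.ofReal (C * r ^ (s - n)) *
          ∫⁻ z in Metric.closedBall u r, localEnergy Ω s p f z ^ (1 / p) := by
  have hϖ := unitBallVolume_pos n
  set ϖ := unitBallVolume n
  -- The power of 4 comes from |w - z| ≤ 4r, and 2^n / ϖ from the volume of a ball of radius at
  -- least r/2.
  set c := 4 ^ ((n : ℝ) + s * p) * 2 ^ n / ϖ
  have hc : 0 < c := by positivity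
  have hp0 : 0 < p := by linarith
  refine ⟨c ^ (1 / p) / ϖ, by positivity, fun Ω f hf u v r r' hr hr' hu hv hd => ?_⟩
  have hr'0 : 0 < r' := by linarith
  have hint : ∀ (x : EuclideanSpace ℝ (Fin n)) (t : ℝ), Metric.closedBall x t ⊆ Ω →
      IntegrableOn f (Metric.closedBall x t) := fun x t hx =>
    (hf.mono hx).integrableOn_compact (isCompact_closedBall _ _)
  have hB0 : ∀ (x : EuclideanSpace ℝ (Fin n)) (t : ℝ), 0 < t →
      volume (Metric.closedBall x t) ≠ 0 := fun x t ht =>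
    (Metric.measure_closedBall_pos _ _ ht).ne'
  have hBt : ∀ (x : EuclideanSpace ℝ (Fin n)) (t : ℝ),
      volume (Metric.closedBall x t) ≠ ⊤ := fun x t => measure_closedBall_lt_top.ne
  set m := ⨍ w in Metric.closedBall v r', f w
  have hpt : ∀ z ∈ Metric.closedBall u r, ‖m - f z‖ₑ ≤
      ENNReal.ofReal (c ^ (1 / p) * r ^ s) * localEnergy Ω s p f z ^ (1 / p) := by
    intro z hz
    have h1 : ‖m - f z‖ₑ ^ p ≤ ENNReal.ofReal (c * r ^ (s * p)) * localEnergy Ω s p f z := by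
      have hsub : Metric.closedBall v r' ⊆ Metric.closedBall z (bdist Ω z / 2) := fun w hw =>
        (hd z hz w hw).1.trans (hd z hz w hw).2
      rw [← enorm_neg, neg_sub]
      calc ‖f z - m‖ₑ ^ p ≤ (volume (Metric.closedBall v r'))⁻¹ *
            ∫⁻ w in Metric.closedBall v r', ‖f z - f w‖ₑ ^ p :=
            enorm_sub_setAverage_rpow_le (hB0 _ _ hr'0) (hBt _ _) (hint _ _ hv) _ hp.le
        _ ≤ (ENNReal.ofReal ((r / 2) ^ n * ϖ))⁻¹ *
            ∫⁻ w in Metric.closedBall v r', ENNReal.ofReal ((4 * r) ^ ((n : ℝ) + s * p)) *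
              ENNReal.ofReal (|f w - f z| ^ p / ‖w - z‖ ^ ((n : ℝ) + s * p)) := by
            refine mul_le_mul' ?_ (setLIntegral_mono' Metric.isClosed_closedBall.measurableSet
              fun w hw => enorm_sub_rpow_le hs hp (hd z hz w hw).1)
            rw [volume_closedBall_eq v hr'0.le]
            gcongr
        _ ≤ (ENNReal.ofReal ((r / 2) ^ n * ϖ))⁻¹ *
            (ENNReal.ofReal ((4 * r) ^ ((n : ℝ) + s * p)) * localEnergy Ω s p f z) := by
            rw [lintegral_const_mul' _ _ ENNReal.ofReal_ne_top]
            exact mul_le_mul_right (mul_le_mul_right (lintegral_mono_set hsub) _) _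
        _ = _ := by
            rw [← mul_assoc, ← ENNReal.ofReal_inv_of_pos (by positivity),
              ← ENNReal.ofReal_mul (by positivity)]
            congr 2
            rw [Real.mul_rpow (by norm_num) hr.le, Real.rpow_add hr, Real.rpow_natCast]
            simp only [c, div_pow]
            field_simp
    calc ‖m - f z‖ₑ = (‖m - f z‖ₑ ^ p) ^ (1 / p) := by
          rw [← ENNReal.rpow_mul, mul_one_div_cancel hp0.ne', ENNReal.rpow_one]
      _ ≤ (ENNReal.ofReal (c * r ^ (s * p)) * localEnergy Ω s p f z) ^ (1 / p) := by gcongr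
      _ = _ := by
          rw [ENNReal.mul_rpow_of_nonneg _ _ (by positivity),
            ENNReal.ofReal_rpow_of_nonneg (by positivity) (by positivity),
            Real.mul_rpow (by positivity) (by positivity), ← Real.rpow_mul hr.le]
          congr 4
          field_simp
  rw [edist_comm, edist_eq_enorm_sub]
  have hJ := enorm_sub_setAverage_rpow_le (hB0 u r hr) (hBt u r) (hint u r hu) m le_rfl
  simp only [ENNReal.rpow_one] at hJ
  calc _ ≤ _ := hJ
    _ ≤ (ENNReal.ofReal (r ^ n * ϖ))⁻¹ * ∫⁻ z in Metric.closedBall u r,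
        ENNReal.ofReal (c ^ (1 / p) * r ^ s) * localEnergy Ω s p f z ^ (1 / p) := by
        rw [volume_closedBall_eq u hr.le]
        exact mul_le_mul_right (setLIntegral_mono' Metric.isClosed_closedBall.measurableSet hpt) _
    _ = _ := by
        rw [lintegral_const_mul' _ _ ENNReal.ofReal_ne_top, ← mul_assoc,
          ← ENNReal.ofReal_inv_of_pos (by positivity), ← ENNReal.ofReal_mul (by positivity)]
        congr 2
        rw [Real.rpow_sub hr, Real.rpow_natCast]
        field_simp

/-- The balls need not be centred at `y` or contain it: they eventually enter each neighbourhood of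
`y`, so continuity there suffices. -/
lemma tendsto_setAverage_closedBall {f : EuclideanSpace ℝ (Fin n) → ℝ} (hΩ : IsOpen Ω)
    (hf : ContinuousOn f Ω) {y : EuclideanSpace ℝ (Fin n)} (hy : y ∈ Ω)
    {u : ℕ → EuclideanSpace ℝ (Fin n)} {r : ℕ → ℝ} (hr : ∀ j, 0 < r j)
    (hu : Filter.Tendsto u Filter.atTop (nhds y)) (hr0 : Filter.Tendsto r Filter.atTop (nhds 0))
    (hsub : ∀ j, Metric.closedBall (u j) (r j) ⊆ Ω) :
    Filter.Tendsto (fun j => ⨍ w in Metric.closedBall (u j) (r j), f w) Filter.atTop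
      (nhds (f y)) := by
  rw [Metric.tendsto_nhds]
  intro ε hε
  obtain ⟨η, hη, hηf⟩ := Metric.continuousAt_iff.1 (hf.continuousAt (hΩ.mem_nhds hy)) (ε / 2)
    (by positivity)
  filter_upwards [Metric.tendsto_nhds.1 hu (η / 2) (by positivity),
    hr0.eventually (gt_mem_nhds (show (0 : ℝ) < η / 2 by positivity))] with j hj1 hj2
  have hmem : ⨍ w in Metric.closedBall (u j) (r j), f w ∈ Metric.closedBall (f y) (ε / 2) := by
    refine (convex_closedBall _ _).set_average_mem Metric.isClosed_closedBall
      (Metric.measure_closedBall_pos _ _ (hr j)).ne' measure_closedBall_lt_top.ne ?_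
      ((hf.mono (hsub j)).integrableOn_compact (isCompact_closedBall _ _))
    refine (ae_restrict_mem Metric.isClosed_closedBall.measurableSet).mono fun w hw => ?_
    refine (hηf ?_).le
    rw [Metric.mem_closedBall] at hw
    linarith [dist_triangle w (u j) y]
  rw [Metric.mem_closedBall] at hmem
  linarith

/-- Chaining along John curves: the oscillation of `f` is controlled by a sum over the scales
`θ ^ j` of averages of the local energy. -/
lemma exists_enorm_sub_le_tsum (hs : 0 < s) (hp : 1 < p) (hΩ : IsJohnDomain Ω) :
    ∃ θ R κ C : ℝ, 0 < θ ∧ θ < 1 ∧ 0 < R ∧ 0 < κ ∧ 0 < C ∧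
      ∀ f : EuclideanSpace ℝ (Fin n) → ℝ, ContinuousOn f Ω → ∃ m : ℝ, ∀ y ∈ Ω,
        ‖f y - m‖ₑ ≤ ENNReal.ofReal C * ∑' j : ℕ, ENNReal.ofReal ((θ ^ j) ^ (s - n)) *
          ∫⁻ z in Ω ∩ {z | dist z y ≤ R * θ ^ j ∧ θ ^ j ≤ κ * bdist Ω z},
            localEnergy Ω s p f z ^ (1 / p) := by
  obtain ⟨hop, -, -, x₀, hx₀, γ, lam, hlam, K, hK, -, -, hend, hmem, hLip, -⟩ := hΩ
  obtain ⟨c, hc, hstep⟩ := exists_edist_setAverage_le n hs hp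
  have hK' : (0 : ℝ) < K := hK
  -- θ ≥ 1/2 keeps consecutive radii within a factor 2. The other bound makes consecutive centres at
  -- most lam θ^j / 8, two radii, apart.
  set θ : ℝ := max (1 / 2) (1 - lam / (8 * K))
  have hθ2 : 1 / 2 ≤ θ := le_max_left _ _
  have hθ0 : 0 < θ := by linarith
  have hθ1 : θ < 1 := max_lt (by norm_num) (by
    have : 0 < lam / (8 * K) := by positivity
    linarith)
  have hθK : K * (1 - θ) ≤ lam / 8 := by
    have h1 : 1 - lam / (8 * K) ≤ θ := le_max_right _ _
    calc (K : ℝ) * (1 - θ) ≤ K * (lam / (8 * K)) := by gcongr; linarith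
      _ = lam / 8 := by field_simp
  -- The j-th centre is within Kθ^j of y and its ball has radius lam θ^j / 16, which gives R. On
  -- that ball d ≥ (15/16) lam θ^j, which gives κ.
  refine ⟨θ, K + lam / 16, 16 / (15 * lam), c * (lam / 16) ^ (s - n), hθ0, hθ1, by positivity,
    by positivity, by positivity, fun f hf => ⟨⨍ w in Metric.closedBall x₀ (lam / 16), f w,
    fun y hy => ?_⟩⟩
  have hpow : ∀ j : ℕ, θ ^ j ∈ Set.Icc (0 : ℝ) 1 := fun j =>
    ⟨by positivity, pow_le_one₀ hθ0.le hθ1.le⟩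
  have hpow0 : ∀ j : ℕ, 0 < θ ^ j := fun j => by positivity
  set u : ℕ → EuclideanSpace ℝ (Fin n) := fun j => γ (θ ^ j) y
  set r : ℕ → ℝ := fun j => lam * θ ^ j / 16
  have hr : ∀ j, 0 < r j := fun j => by simp only [r]; have := hpow0 j; positivity
  have hdu : ∀ j, ∀ z ∈ Metric.closedBall (u j) (r j), 15 / 16 * (lam * θ ^ j) ≤ bdist Ω z := by
    intro j z hz
    have h1 := (hmem y hy _ (hpow j)).2
    have h2 := bdist_le_add_dist (Ω := Ω) (u j) z
    rw [Metric.mem_closedBall, dist_comm] at hz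
    simp only [r, u] at *
    linarith
  have hsub : ∀ j, Metric.closedBall (u j) (r j) ⊆ Ω := by
    intro j z hz
    refine mem_of_dist_lt_bdist hop (hmem y hy _ (hpow j)).1 ?_
    have h1 := (hmem y hy _ (hpow j)).2
    have h2 := hr j
    rw [Metric.mem_closedBall] at hz
    simp only [r, u] at *
    linarith
  have hLip' : ∀ t ∈ Set.Icc (0 : ℝ) 1, ∀ t' ∈ Set.Icc (0 : ℝ) 1,
      dist (γ t y) (γ t' y) ≤ K * |t - t'| := fun t ht t' ht' =>
    (hLip y hy).dist_le_mul t ht t' ht'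
  have hu0 : ∀ j, dist (u j) y ≤ K * θ ^ j := by
    intro j
    have := hLip' _ (hpow j) 0 ⟨le_rfl, zero_le_one⟩
    rwa [(hend y hy).1, sub_zero, abs_of_pos (hpow0 j)] at this
  have hθlim : Filter.Tendsto (fun j : ℕ => θ ^ j) Filter.atTop (nhds 0) :=
    tendsto_pow_atTop_nhds_zero_of_lt_one hθ0.le hθ1
  have hulim : Filter.Tendsto u Filter.atTop (nhds y) := by
    refine tendsto_iff_dist_tendsto_zero.2 (squeeze_zero (fun _ => dist_nonneg) hu0 ?_)
    simpa using hθlim.const_mul (K : ℝ)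
  have hrlim : Filter.Tendsto r Filter.atTop (nhds 0) := by
    simpa [r] using (hθlim.const_mul lam).div_const 16
  have hstep' : ∀ j, edist (⨍ w in Metric.closedBall (u j) (r j), f w)
      (⨍ w in Metric.closedBall (u j.succ) (r j.succ), f w) ≤
        ENNReal.ofReal (c * r j ^ (s - n)) *
          ∫⁻ z in Metric.closedBall (u j) (r j), localEnergy Ω s p f z ^ (1 / p) := by
    intro j
    refine hstep Ω f hf _ _ _ _ (hr j) ?_ (hsub j) (hsub _) fun z hz w hw => ⟨?_, ?_⟩
    · simp only [r, Nat.succ_eq_add_one, pow_succ]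
      have := hpow0 j
      have : lam * θ ^ j * (1 / 2) ≤ lam * θ ^ j * θ := by gcongr
      linarith
    · have h1 := hLip' _ (hpow j.succ) _ (hpow j)
      have h2 : |θ ^ j.succ - θ ^ j| = θ ^ j * (1 - θ) := by
        rw [Nat.succ_eq_add_one, pow_succ, abs_sub_comm, abs_of_nonneg]
        · ring
        · have := hpow0 j
          nlinarith
      have h3 : K * |θ ^ j.succ - θ ^ j| ≤ θ ^ j * (lam / 8) := by
        rw [h2, mul_left_comm]
        gcongr
      have h4 : r j.succ ≤ r j := by
        simp only [r]
        gcongr lam * ?_ / 16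
        exact pow_le_pow_of_le_one hθ0.le hθ1.le (Nat.le_succ j)
      rw [Metric.mem_closedBall] at hz hw
      rw [dist_comm] at hz
      -- The three distances are at most one, two and one times `r j`: total 4 `r j`.
      have h5 := dist_triangle4 w (u j.succ) (u j) z
      have h6 : r j = lam * θ ^ j / 16 := rfl
      have h7 : dist (u j.succ) (u j) ≤ θ ^ j * (lam / 8) := h1.trans h3
      linarith
    · have h1 := hdu j z hz
      have := hpow0 j
      have : 0 < lam * θ ^ j := by positivity
      simp only [r]
      linarith
  have htel := edist_le_tsum_of_edist_le_of_tendsto₀ _ hstep'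
    (tendsto_setAverage_closedBall hop hf hy hr hulim hrlim hsub)
  -- At j = 0 the time is 1, where all curves sit at x₀, so the starting average is the same for
  -- every y.
  have h0 : u 0 = x₀ := by simp [u, (hend y hy).2]
  have h0' : r 0 = lam / 16 := by simp [r]
  rw [h0, h0', edist_comm, edist_eq_enorm_sub] at htel
  refine htel.trans ?_
  rw [← ENNReal.tsum_mul_left]
  refine ENNReal.tsum_le_tsum fun j => ?_
  have hrj : r j ^ (s - n) = (lam / 16) ^ (s - n) * (θ ^ j) ^ (s - n) := by
    rw [← Real.mul_rpow (by positivity) (hpow0 j).le]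
    congr 1
    simp only [r]
    ring
  rw [hrj, ← mul_assoc, ENNReal.ofReal_mul (by positivity), mul_assoc]
  gcongr
  refine fun z hz => ⟨hsub j hz, ?_, ?_⟩
  · rw [Metric.mem_closedBall] at hz
    have := dist_triangle z (u j) y
    have h6 : r j = lam * θ ^ j / 16 := rfl
    linarith [hu0 j]
  · have h1 := hdu j z hz
    calc θ ^ j = 16 / (15 * lam) * (15 / 16 * (lam * θ ^ j)) := by field_simp
      _ ≤ _ := by gcongr

end Chain

/-! ### Geometric sums and the Hedberg inequality -/

section GeometricSums

variable {θ : ℝ}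

lemma tsum_ofReal_mul_pow {A q : ℝ} (hA : 0 ≤ A) (hq0 : 0 ≤ q) (hq1 : q < 1) :
    ∑' k : ℕ, ENNReal.ofReal (A * q ^ k) = ENNReal.ofReal (A / (1 - q)) := by
  rw [← ENNReal.ofReal_tsum_of_nonneg (fun k => by positivity)
    ((summable_geometric_of_lt_one hq0 hq1).mul_left A), tsum_mul_left,
    tsum_geometric_of_lt_one hq0 hq1, div_eq_mul_inv]

lemma exists_pow_le_iff (hθ0 : 0 < θ) (hθ1 : θ < 1) {ρ : ℝ} (hρ : 0 < ρ) :
    ∃ j₀ : ℕ, ∀ j : ℕ, θ ^ j ≤ ρ ↔ j₀ ≤ j := by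
  classical
  have hex : ∃ j : ℕ, θ ^ j ≤ ρ := (exists_pow_lt_of_lt_one hρ hθ1).imp fun _ h => h.le
  refine ⟨Nat.find hex, fun j => ⟨fun h => Nat.find_min' hex h, fun h => ?_⟩⟩
  exact (pow_le_pow_of_le_one hθ0.le hθ1.le h).trans (Nat.find_spec hex)

lemma tsum_ite_pow_le (hθ0 : 0 < θ) (hθ1 : θ < 1) {σ ρ : ℝ} (hσ : 0 < σ) (hρ : 0 < ρ) :
    ∑' j : ℕ, (if θ ^ j ≤ ρ then ENNReal.ofReal ((θ ^ j) ^ σ) else 0) ≤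
      ENNReal.ofReal (ρ ^ σ / (1 - θ ^ σ)) := by
  obtain ⟨j₀, hj₀⟩ := exists_pow_le_iff hθ0 hθ1 hρ
  rw [← tsum_ofReal_mul_pow (by positivity) (by positivity) (Real.rpow_lt_one hθ0.le hθ1 hσ),
    ← Summable.sum_add_tsum_nat_add' (k := j₀) ENNReal.summable, Finset.sum_eq_zero, zero_add]
  · refine ENNReal.tsum_le_tsum fun k => ?_
    rw [if_pos ((hj₀ _).2 (Nat.le_add_left _ _))]
    refine ENNReal.ofReal_le_ofReal ?_
    rw [← Real.rpow_natCast (θ ^ σ), ← Real.rpow_mul hθ0.le, mul_comm σ, Real.rpow_mul hθ0.le,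
      Real.rpow_natCast, ← Real.mul_rpow hρ.le (by positivity), add_comm, pow_add]
    gcongr
    exact (hj₀ j₀).2 le_rfl
  · intro j hj
    rw [if_neg fun h => (Finset.mem_range.1 hj).not_ge ((hj₀ j).1 h)]

lemma tsum_ite_lt_pow_le (hθ0 : 0 < θ) (hθ1 : θ < 1) {β ρ : ℝ} (hβ : 0 < β) (hρ : 0 < ρ) :
    ∑' j : ℕ, (if ρ < θ ^ j then ENNReal.ofReal ((θ ^ j) ^ (-β)) else 0) ≤
      ENNReal.ofReal (ρ ^ (-β) / (1 - θ ^ β)) := by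
  obtain ⟨j₀, hj₀⟩ := exists_pow_le_iff hθ0 hθ1 hρ
  rw [← tsum_ofReal_mul_pow (by positivity) (by positivity) (Real.rpow_lt_one hθ0.le hθ1 hβ),
    -- Read backwards, the sum starts at the smallest scale above ρ and its terms decay
    -- geometrically.
    tsum_eq_sum (s := Finset.range j₀), ← Finset.sum_range_reflect]
  · refine (Finset.sum_le_sum fun k hk => ?_).trans (ENNReal.sum_le_tsum (Finset.range j₀))
    rw [Finset.mem_range] at hk
    split_ifs with h
    · refine ENNReal.ofReal_le_ofReal ?_
      have hlast : ρ ≤ θ ^ (j₀ - 1) := by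
        by_contra hlt
        have := (hj₀ (j₀ - 1)).1 (not_le.1 hlt).le
        omega
      have hsplit : θ ^ (j₀ - 1) = θ ^ (j₀ - 1 - k) * θ ^ k := by
        rw [← pow_add]; congr 1; omega
      have hk0 : 0 < θ ^ (j₀ - 1 - k) := by positivity
      rw [← Real.rpow_natCast (θ ^ β), ← Real.rpow_mul hθ0.le, mul_comm β, Real.rpow_mul hθ0.le,
        Real.rpow_natCast, Real.rpow_neg hk0.le, Real.rpow_neg hρ.le, inv_mul_eq_div,
        le_div_iff₀ (by positivity), inv_mul_le_iff₀ (by positivity),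
        ← Real.mul_rpow (by positivity) (by positivity), ← hsplit]
      gcongr
    · exact zero_le
  · intro j hj
    rw [if_neg fun h => hj (Finset.mem_range.2 (lt_of_not_ge fun h' => h.not_ge ((hj₀ j).2 h')))]

/-- A Hedberg-type inequality for sums over scales. -/
lemma exists_mul_tsum_scales_le (hθ0 : 0 < θ) (hθ1 : θ < 1) {s κ α ν : ℝ} (hs : 0 < s)
    (hκ : 0 < κ) (hα0 : 0 ≤ α) (hαs : α ≤ s) (hαν : α < ν) :
    ∃ C : ℝ, 0 < C ∧ ∀ (d : ℝ) (M B : ℝ≥0∞) (a : ℕ → ℝ≥0∞), 0 < d → M ≠ ⊤ → B ≠ ⊤ →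
      (∀ j, a j ≤ M) → (∀ j, a j ≤ B * ENNReal.ofReal ((θ ^ j) ^ (-ν))) →
      ∑' j : ℕ, (if θ ^ j ≤ κ * d then ENNReal.ofReal ((θ ^ j) ^ s) * a j else 0) ≤
        ENNReal.ofReal (C * d ^ (s - α)) * (M ^ (1 - α / ν) * B ^ (α / ν)) := by
  have hν : 0 < ν := by linarith
  have hη0 : 0 ≤ α / ν := by positivity
  have hη1 : α / ν < 1 := (div_lt_one hν).2 hαν
  have hpow0 : ∀ j : ℕ, 0 < θ ^ j := fun j => by positivity
  -- For α < s, a geometric mean of the two bounds leaves θ^(j(s-α)), summable over θ^j ≤ κd. For α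
  -- = s nothing is left to sum, so the scales are split at a threshold instead.
  rcases hαs.lt_or_eq with hlt | heq
  · have hq : θ ^ (s - α) < 1 := Real.rpow_lt_one hθ0.le hθ1 (by linarith)
    have hq' : 0 < 1 - θ ^ (s - α) := by linarith
    refine ⟨κ ^ (s - α) / (1 - θ ^ (s - α)), by positivity, fun d M B a hd _ _ haM haB => ?_⟩
    have hterm : ∀ j : ℕ, (if θ ^ j ≤ κ * d then ENNReal.ofReal ((θ ^ j) ^ s) * a j else 0) ≤
        (if θ ^ j ≤ κ * d then ENNReal.ofReal ((θ ^ j) ^ (s - α)) else 0) *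
          (M ^ (1 - α / ν) * B ^ (α / ν)) := by
      intro j
      split_ifs with h
      · have h1 : a j ≤ M ^ (1 - α / ν) *
            (B ^ (α / ν) * ENNReal.ofReal ((θ ^ j) ^ (-α))) := by
          calc a j = a j ^ (1 - α / ν) * a j ^ (α / ν) := by
                rw [← ENNReal.rpow_add_of_nonneg _ _ (by linarith) hη0, sub_add_cancel,
                  ENNReal.rpow_one]
            _ ≤ M ^ (1 - α / ν) * (B * ENNReal.ofReal ((θ ^ j) ^ (-ν))) ^ (α / ν) := by
                gcongr
                · exact haM j
                · exact haB j
            _ = _ := by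
                rw [ENNReal.mul_rpow_of_nonneg _ _ hη0,
                  ENNReal.ofReal_rpow_of_nonneg (by positivity) hη0,
                  ← Real.rpow_mul (hpow0 j).le]
                congr 5
                field_simp
        calc _ ≤ ENNReal.ofReal ((θ ^ j) ^ s) * (M ^ (1 - α / ν) *
              (B ^ (α / ν) * ENNReal.ofReal ((θ ^ j) ^ (-α)))) := by gcongr
          _ = (ENNReal.ofReal ((θ ^ j) ^ s) * ENNReal.ofReal ((θ ^ j) ^ (-α))) *
              (M ^ (1 - α / ν) * B ^ (α / ν)) := by ring
          _ = _ := by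
              rw [← ENNReal.ofReal_mul (by positivity), ← Real.rpow_add (hpow0 j), ← sub_eq_add_neg]
      · exact zero_le
    refine (ENNReal.tsum_le_tsum hterm).trans ?_
    rw [ENNReal.tsum_mul_right]
    gcongr
    refine (tsum_ite_pow_le hθ0 hθ1 (by linarith) (by positivity)).trans (le_of_eq ?_)
    rw [Real.mul_rpow hκ.le hd.le]
    congr 1
    ring
  · subst heq
    have hq : θ ^ α < 1 := Real.rpow_lt_one hθ0.le hθ1 hs
    have hq' : θ ^ (ν - α) < 1 := Real.rpow_lt_one hθ0.le hθ1 (by linarith)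
    have h1 : 0 < 1 / (1 - θ ^ α) := one_div_pos.2 (by linarith)
    have h2 : 0 < 1 / (1 - θ ^ (ν - α)) := one_div_pos.2 (by linarith)
    refine ⟨1 / (1 - θ ^ α) + 1 / (1 - θ ^ (ν - α)), by positivity,
      fun d M B a hd hM hB haM haB => ?_⟩
    by_cases ha : ∀ j, a j = 0
    · simp [ha]
    push Not at ha
    obtain ⟨i, hi⟩ := ha
    have hM0 : M ≠ 0 := fun h => hi (le_zero_iff.1 (h ▸ haM i))
    have hB0 : B ≠ 0 := fun h => hi (le_zero_iff.1 (by simpa [h] using haB i))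
    lift M to ℝ≥0 using hM
    lift B to ℝ≥0 using hB
    have hMpos : (0 : ℝ) < M := by
      rw [NNReal.coe_pos]; exact pos_iff_ne_zero.2 (by simpa using hM0)
    have hBpos : (0 : ℝ) < B := by
      rw [NNReal.coe_pos]; exact pos_iff_ne_zero.2 (by simpa using hB0)
    have hcM : (M : ℝ≥0∞) = ENNReal.ofReal M := by simp
    have hcB : (B : ℝ≥0∞) = ENNReal.ofReal B := by simp
    -- The scale at which both bounds agree, M = Bρ^(-ν): M is used below it, B above it.
    set ρ : ℝ := ((B : ℝ) / M) ^ (1 / ν)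
    have hρ : 0 < ρ := by positivity
    have hρM : ρ ^ α * M = (M : ℝ) ^ (1 - α / ν) * (B : ℝ) ^ (α / ν) := by
      rw [← Real.rpow_mul (by positivity), Real.div_rpow hBpos.le hMpos.le, Real.rpow_sub hMpos,
        Real.rpow_one, one_div_mul_eq_div]
      field_simp
    have hρB : ρ ^ (-(ν - α)) * B = (M : ℝ) ^ (1 - α / ν) * (B : ℝ) ^ (α / ν) := by
      have : 1 / ν * -(ν - α) = α / ν - 1 := by field_simp; ring
      rw [← Real.rpow_mul (by positivity), this, Real.div_rpow hBpos.le hMpos.le,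
        Real.rpow_sub hMpos, Real.rpow_sub hMpos, Real.rpow_sub hBpos, Real.rpow_one,
        Real.rpow_one]
      field_simp
    have hterm : ∀ j : ℕ, (if θ ^ j ≤ κ * d then ENNReal.ofReal ((θ ^ j) ^ α) * a j else 0) ≤
        (if θ ^ j ≤ ρ then ENNReal.ofReal ((θ ^ j) ^ α) else 0) * M +
        (if ρ < θ ^ j then ENNReal.ofReal ((θ ^ j) ^ (-(ν - α))) else 0) * B := by
      intro j
      split_ifs with h h' h'' h''
      · exact absurd h'' h'.not_gt
      · rw [zero_mul, add_zero]
        exact mul_le_mul_right (haM j) _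
      · rw [zero_mul, zero_add]
        calc _ ≤ ENNReal.ofReal ((θ ^ j) ^ α) * (B * ENNReal.ofReal ((θ ^ j) ^ (-ν))) :=
              mul_le_mul_right (haB j) _
          _ = (ENNReal.ofReal ((θ ^ j) ^ α) * ENNReal.ofReal ((θ ^ j) ^ (-ν))) * B := by ring
          _ = _ := by
              rw [← ENNReal.ofReal_mul (by positivity), ← Real.rpow_add (hpow0 j)]
              congr 3
              ring
      · exact absurd (not_le.1 h') h''
      all_goals exact zero_le
    refine (ENNReal.tsum_le_tsum hterm).trans ?_
    rw [ENNReal.tsum_add, ENNReal.tsum_mul_right, ENNReal.tsum_mul_right]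
    refine (add_le_add (mul_le_mul_left (tsum_ite_pow_le hθ0 hθ1 hs hρ) _)
      (mul_le_mul_left (tsum_ite_lt_pow_le hθ0 hθ1 (by linarith) hρ) _)).trans (le_of_eq ?_)
    have e1 : ENNReal.ofReal (ρ ^ α / (1 - θ ^ α)) * M = ENNReal.ofReal (1 / (1 - θ ^ α) *
        ((M : ℝ) ^ (1 - α / ν) * (B : ℝ) ^ (α / ν))) := by
      rw [hcM, ← ENNReal.ofReal_mul (div_nonneg (by positivity) (by linarith)), ← hρM]
      congr 1
      ring
    have e2 : ENNReal.ofReal (ρ ^ (-(ν - α)) / (1 - θ ^ (ν - α))) * B =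
        ENNReal.ofReal (1 / (1 - θ ^ (ν - α)) *
          ((M : ℝ) ^ (1 - α / ν) * (B : ℝ) ^ (α / ν))) := by
      rw [hcB, ← ENNReal.ofReal_mul (div_nonneg (by positivity) (by linarith)), ← hρB]
      congr 1
      ring
    rw [e1, e2, hcM, hcB, ENNReal.ofReal_rpow_of_pos hMpos, ENNReal.ofReal_rpow_of_pos hBpos,
      ← ENNReal.ofReal_add (by positivity) (by positivity),
      ← ENNReal.ofReal_mul (by positivity), ← ENNReal.ofReal_mul (by positivity), sub_self,
      Real.rpow_zero]
    congr 1
    ring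

end GeometricSums

/-! ### From the dual estimate to the norm -/

section Duality

/-- A measurable function whose truncations satisfy the dual estimate satisfies the norm
estimate. -/
lemma lintegral_rpow_le_of_truncation {α : Type*} [MeasurableSpace α] {μ : Measure α}
    [IsFiniteMeasure μ] {u : α → ℝ≥0∞} (hu : Measurable u) (hut : ∀ x, u x ≠ ⊤) {q : ℝ}
    (hq : 1 < q) {A : ℝ≥0∞}
    (H : ∀ N : ℕ, ∫⁻ x, min (u x) N ^ (q - 1) * u x ∂μ ≤
      A * (∫⁻ x, min (u x) N ^ q ∂μ) ^ (1 - 1 / q)) :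
    (∫⁻ x, u x ^ q ∂μ) ^ (1 / q) ≤ A := by
  have hq0 : 0 < q := by linarith
  have hX : ∀ N : ℕ, ∫⁻ x, min (u x) N ^ q ∂μ ≤ A ^ q := by
    intro N
    set X := ∫⁻ x, min (u x) N ^ q ∂μ
    -- Truncation and finite measure make X finite, so X^(1 - 1/q) can be cancelled.
    have hXt : X ≠ ⊤ := by
      refine ((lintegral_mono fun x => ENNReal.rpow_le_rpow (min_le_right _ _) hq0.le).trans_lt
        ?_).ne
      rw [lintegral_const]
      exact ENNReal.mul_lt_top (ENNReal.rpow_lt_top_of_nonneg hq0.le (ENNReal.natCast_ne_top N))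
        (measure_lt_top _ _)
    have h1 : X ≤ A * X ^ (1 - 1 / q) := by
      refine (lintegral_mono fun x => ?_).trans (H N)
      calc min (u x) N ^ q = min (u x) N ^ (q - 1) * min (u x) N := by
            nth_rw 3 [← ENNReal.rpow_one (min (u x) N)]
            rw [← ENNReal.rpow_add_of_nonneg _ _ (by linarith) zero_le_one, sub_add_cancel]
        _ ≤ _ := by gcongr; exact min_le_left _ _
    rcases eq_or_ne X 0 with hX0 | hX0
    · rw [hX0]; exact zero_le
    have h2 : X ^ (1 / q) ≤ A := by
      have h3 : X ^ (1 / q) * X ^ (1 - 1 / q) ≤ A * X ^ (1 - 1 / q) := by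
        rw [← ENNReal.rpow_add _ _ hX0 hXt, add_sub_cancel, ENNReal.rpow_one]
        exact h1
      refine (ENNReal.mul_le_mul_iff_left ?_ ?_).1 h3
      · exact (ENNReal.rpow_pos (pos_iff_ne_zero.2 hX0) hXt).ne'
      · exact ENNReal.rpow_ne_top_of_ne_zero hX0 hXt
    calc X = (X ^ (1 / q)) ^ q := by
          rw [← ENNReal.rpow_mul, one_div_mul_cancel hq0.ne', ENNReal.rpow_one]
      _ ≤ A ^ q := by gcongr
  have hlim : ∫⁻ x, u x ^ q ∂μ ≤ A ^ q := by
    have hsup : ∀ x, u x ^ q = ⨆ N : ℕ, min (u x) N ^ q := by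
      intro x
      refine le_antisymm ?_ (iSup_le fun N => by gcongr; exact min_le_left _ _)
      obtain ⟨N, hN⟩ := ENNReal.exists_nat_gt (hut x)
      refine le_iSup_of_le N ?_
      rw [min_eq_left hN.le]
    simp_rw [hsup]
    rw [lintegral_iSup (fun N => (hu.min measurable_const).pow_const q)]
    · exact iSup_le hX
    · intro N N' hNN' x
      dsimp only
      gcongr
  calc _ ≤ (A ^ q) ^ (1 / q) := by gcongr
    _ = A := by rw [← ENNReal.rpow_mul, mul_one_div_cancel hq0.ne', ENNReal.rpow_one]

end Duality

/-! ### The dual estimate -/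

section DualEstimate

variable {n : ℕ} {Ω : Set (EuclideanSpace ℝ (Fin n))}

lemma measurable_localEnergy {s p : ℝ} {f : EuclideanSpace ℝ (Fin n) → ℝ} (hf : Measurable f) :
    Measurable (localEnergy Ω s p f) := by
  have hd : Continuous (bdist Ω) := continuous_bdist
  set A := {x : EuclideanSpace ℝ (Fin n) × EuclideanSpace ℝ (Fin n) |
    dist x.2 x.1 ≤ bdist Ω x.1 / 2}
  have hA : MeasurableSet A := (isClosed_le (by fun_prop) (by fun_prop)).measurableSet
  have : localEnergy Ω s p f = fun z => ∫⁻ w, A.indicator (fun x =>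
      ENNReal.ofReal (|f x.2 - f x.1| ^ p / ‖x.2 - x.1‖ ^ ((n : ℝ) + s * p))) (z, w) := by
    ext z
    rw [localEnergy, ← lintegral_indicator Metric.isClosed_closedBall.measurableSet]
    rfl
  rw [this]
  refine Measurable.lintegral_prod_right' (Measurable.indicator ?_ hA)
  fun_prop

/-- Interchanging the order of integration in the chaining estimate. -/
lemma lintegral_mul_tsum_scales_le (hΩ : IsOpen Ω) {θ R κ t : ℝ} (hR : 0 < R)
    (ht : 0 ≤ t) {h g : EuclideanSpace ℝ (Fin n) → ℝ≥0∞} (hh : Measurable h)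
    (hg : Measurable g) (c : ℕ → ℝ≥0∞) :
    ∫⁻ y in Ω, h y * (ENNReal.ofReal (bdist Ω y ^ t) * ∑' j : ℕ, c j *
        ∫⁻ z in Ω ∩ {z | dist z y ≤ R * θ ^ j ∧ θ ^ j ≤ κ * bdist Ω z}, g z) ≤
      ∫⁻ z in Ω, g z * (ENNReal.ofReal (((1 + R * κ) * bdist Ω z) ^ t) *
        ∑' j : ℕ, if θ ^ j ≤ κ * bdist Ω z then
          c j * ∫⁻ y in Metric.closedBall z (R * θ ^ j), h y else 0) := by
  have hd : Continuous (bdist Ω) := continuous_bdist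
  set A : ℕ → Set (EuclideanSpace ℝ (Fin n) × EuclideanSpace ℝ (Fin n)) := fun j =>
    {x | dist x.2 x.1 ≤ R * θ ^ j ∧ θ ^ j ≤ κ * bdist Ω x.2}
  have hκd : ∀ j : ℕ, MeasurableSet {z | θ ^ j ≤ κ * bdist Ω z} := fun j =>
    (isClosed_le (by fun_prop) (by fun_prop)).measurableSet
  have hA : ∀ j, MeasurableSet (A j) := by
    intro j
    have h1 : MeasurableSet {x : EuclideanSpace ℝ (Fin n) × EuclideanSpace ℝ (Fin n) |
        dist x.2 x.1 ≤ R * θ ^ j} := (isClosed_le (by fun_prop) (by fun_prop)).measurableSet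
    exact h1.inter (measurable_snd (hκd j))
  set F : ℕ → EuclideanSpace ℝ (Fin n) × EuclideanSpace ℝ (Fin n) → ℝ≥0∞ := fun j =>
    (A j).indicator fun x => h x.1 * ENNReal.ofReal (bdist Ω x.1 ^ t) * c j * g x.2
  have hF : ∀ j, Measurable (F j) := fun j => Measurable.indicator (by fun_prop) (hA j)
  have hsec : ∀ y j, MeasurableSet {z : EuclideanSpace ℝ (Fin n) |
      dist z y ≤ R * θ ^ j ∧ θ ^ j ≤ κ * bdist Ω z} := fun y j =>
    (Metric.isClosed_closedBall (x := y) (ε := R * θ ^ j)).measurableSet.inter (hκd j)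
  have hleft : ∀ y, h y * (ENNReal.ofReal (bdist Ω y ^ t) * ∑' j : ℕ, c j *
      ∫⁻ z in Ω ∩ {z | dist z y ≤ R * θ ^ j ∧ θ ^ j ≤ κ * bdist Ω z}, g z) =
      ∑' j, ∫⁻ z in Ω, F j (y, z) := by
    intro y
    rw [← mul_assoc, ← ENNReal.tsum_mul_left]
    congr 1 with j
    rw [Set.inter_comm, ← Measure.restrict_restrict (hsec y j), ← lintegral_indicator (hsec y j),
      ← mul_assoc, ← lintegral_const_mul _ (hg.indicator (hsec y j))]
    congr 1 with z
    by_cases hz : dist z y ≤ R * θ ^ j ∧ θ ^ j ≤ κ * bdist Ω z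
    · simp [F, A, hz]
    · simp [F, A, hz]
  simp_rw [hleft]
  rw [lintegral_tsum fun j => ((hF j).lintegral_prod_right').aemeasurable]
  have hswap : ∀ j, ∫⁻ y in Ω, ∫⁻ z in Ω, F j (y, z) = ∫⁻ z in Ω, ∫⁻ y in Ω, F j (y, z) :=
    fun j => lintegral_lintegral_swap (hF j).aemeasurable
  simp_rw [hswap]
  rw [← lintegral_tsum fun j => ((hF j).lintegral_prod_left').aemeasurable]
  refine setLIntegral_mono' hΩ.measurableSet fun z _ => ?_
  rw [← mul_assoc, ← ENNReal.tsum_mul_left]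
  refine ENNReal.tsum_le_tsum fun j => ?_
  split_ifs with hj
  · calc ∫⁻ y in Ω, F j (y, z) ≤ ∫⁻ y, F j (y, z) := setLIntegral_le_lintegral _ _
      _ ≤ ∫⁻ y, (g z * ENNReal.ofReal (((1 + R * κ) * bdist Ω z) ^ t) * c j) *
            (Metric.closedBall z (R * θ ^ j)).indicator h y := by
          refine lintegral_mono fun y => ?_
          by_cases hy : dist z y ≤ R * θ ^ j
          · have hb : bdist Ω y ≤ (1 + R * κ) * bdist Ω z := by
              have h1 := bdist_le_add_dist (Ω := Ω) y z
              have h2 : R * θ ^ j ≤ R * (κ * bdist Ω z) := by gcongr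
              rw [dist_comm] at h1
              linarith
            have hb0 : 0 ≤ bdist Ω y := Metric.infDist_nonneg
            have hy' : y ∈ Metric.closedBall z (R * θ ^ j) := by
              rwa [Metric.mem_closedBall, dist_comm]
            have hmem : (y, z) ∈ A j := ⟨hy, hj⟩
            simp only [F]
            rw [Set.indicator_of_mem hmem, Set.indicator_of_mem hy']
            calc h y * ENNReal.ofReal (bdist Ω y ^ t) * c j * g z
                ≤ h y * ENNReal.ofReal (((1 + R * κ) * bdist Ω z) ^ t) * c j * g z := by gcongr
              _ = _ := by ring
          · have hmem : (y, z) ∉ A j := fun h => hy h.1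
            simp only [F]
            rw [Set.indicator_of_notMem hmem]
            exact zero_le
      _ = _ := by
          rw [lintegral_const_mul _ (hh.indicator Metric.isClosed_closedBall.measurableSet),
            lintegral_indicator Metric.isClosed_closedBall.measurableSet, mul_assoc]
  · have : ∀ y, F j (y, z) = 0 := fun y =>
      Set.indicator_of_notMem (fun h : (y, z) ∈ A j => hj h.2) _
    simp [this]

/-- Hölder against the constant 1. This supplies the r^(-n/q') bound on averages in the Hedberg
argument. -/
lemma inv_volume_mul_setLIntegral_le {q q' : ℝ} (hq : q'.HolderConjugate q)
    {h : EuclideanSpace ℝ (Fin n) → ℝ≥0∞} (hh : Measurable h) (z : EuclideanSpace ℝ (Fin n))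
    {r : ℝ} (hr : 0 < r) :
    (volume (Metric.closedBall z r))⁻¹ * ∫⁻ y in Metric.closedBall z r, h y ≤
      ENNReal.ofReal ((r ^ n * unitBallVolume n) ^ (-(1 / q'))) *
        (∫⁻ y, h y ^ q') ^ (1 / q') := by
  have hϖ := unitBallVolume_pos n
  have hH := ENNReal.lintegral_mul_le_Lp_mul_Lq (volume.restrict (Metric.closedBall z r)) hq
    hh.aemeasurable (g := fun _ => 1) aemeasurable_const
  simp only [Pi.mul_apply, mul_one, ENNReal.one_rpow, lintegral_const,
    Measure.restrict_apply_univ, one_mul] at hH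
  rw [volume_closedBall_eq z hr.le] at hH ⊢
  set v := r ^ n * unitBallVolume n
  have hv : 0 < v := by positivity
  clear_value v
  have hexp : -(1 / q') = -1 + 1 / q := by
    have := hq.inv_add_inv_eq_one
    rw [one_div, one_div]
    linarith
  calc _ ≤ (ENNReal.ofReal v)⁻¹ * ((∫⁻ y, h y ^ q') ^ (1 / q') *
        ENNReal.ofReal v ^ (1 / q)) := by
        refine mul_le_mul_right (hH.trans (mul_le_mul_left ?_ _)) _
        have := hq.pos
        gcongr
        exact Measure.restrict_le_self
    _ = ((ENNReal.ofReal v)⁻¹ * ENNReal.ofReal v ^ (1 / q)) *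
        (∫⁻ y, h y ^ q') ^ (1 / q') := by ring
    _ = _ := by
        rw [hexp, Real.rpow_add hv, Real.rpow_neg_one, ENNReal.ofReal_mul (by positivity),
          ENNReal.ofReal_inv_of_pos hv, ENNReal.ofReal_rpow_of_pos hv]

/-- The estimate of the weighted oscillation tested against a bounded function. -/
lemma exists_lintegral_mul_enorm_sub_le (hn : 0 < n) (hΩ : IsJohnDomain Ω)
    (hpos : ∀ x ∈ Ω, 0 < bdist Ω x) {s p q p' q' a α b : ℝ}
    (hs : 0 < s) (hp : p.HolderConjugate p') (hq : q.HolderConjugate q')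
    (ha : 0 ≤ a) (hα : α = n / p - n / q) (hα0 : 0 ≤ α) (hαs : α ≤ s)
    (hb : b = p * (a / q + s - α)) :
    ∃ C : ℝ, 0 < C ∧ ∀ f : EuclideanSpace ℝ (Fin n) → ℝ, Measurable f → ContinuousOn f Ω →
      ∃ m : ℝ, ∀ h : EuclideanSpace ℝ (Fin n) → ℝ≥0∞, Measurable h →
        ∀ N : ℝ≥0, (∀ x, h x ≤ N) → ∫⁻ y, h y ^ q' ≠ ⊤ →
        ∫⁻ y in Ω, h y * (ENNReal.ofReal (bdist Ω y ^ (a / q)) * ‖f y - m‖ₑ) ≤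
          ENNReal.ofReal C *
            (∫⁻ z in Ω, localEnergy Ω s p f z * ENNReal.ofReal (bdist Ω z ^ b)) ^ (1 / p) *
              (∫⁻ y, h y ^ q') ^ (1 / q') := by
  have hop : IsOpen Ω := hΩ.1
  have hn' : (0 : ℝ) < n := by exact_mod_cast hn
  have hp0 := hp.pos
  have hq0 := hq.pos
  have hp'0 := hp.symm.pos
  have hq'0 := hq.symm.pos
  have hϖ := unitBallVolume_pos n
  have hpp := hp.inv_add_inv_eq_one
  have hqq := hq.inv_add_inv_eq_one
  have hν : α < n / q' := by
    have : (n : ℝ) / q' - α = n / p' := by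
      rw [hα]
      simp only [div_eq_mul_inv]
      linear_combination (n : ℝ) * hqq - n * hpp
    have : 0 < (n : ℝ) / p' := by positivity
    linarith
  -- The maximal function thus enters with power q'/p', whose p'-th power is (Mh)^{q'}, integrable
  -- by the maximal theorem.
  have hratio : α / (n / q') = 1 - q' / p' := by
    have : α = n / q' - n / p' := by
      rw [hα]
      simp only [div_eq_mul_inv]
      linear_combination n * hpp - (n : ℝ) * hqq
    rw [this]
    field_simp
  have hratio0 : 0 ≤ 1 - q' / p' := by rw [← hratio]; positivity
  obtain ⟨θ, R, κ, C₁, hθ0, hθ1, hR, hκ, hC₁, hchain⟩ :=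
    exists_enorm_sub_le_tsum hs hp.lt hΩ
  obtain ⟨C₂, hC₂, hscale⟩ := exists_mul_tsum_scales_le hθ0 hθ1 hs hκ hα0 hαs hν
  obtain ⟨C₃, hmax⟩ := exists_lintegral_maximalFn_rpow_le
    (volume : Measure (EuclideanSpace ℝ (Fin n))) hq.symm.lt
  have hpow0 : ∀ j : ℕ, 0 < θ ^ j := fun j => by positivity
  set V := R ^ n * unitBallVolume n
  have hV : 0 < V := by positivity
  set ρ : ℕ → ℝ := fun j => R * θ ^ j
  have hρ0 : ∀ j, 0 < ρ j := fun j => by simp only [ρ]; positivity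
  have hρR : ∀ j, ρ j ≤ R := fun j => mul_le_of_le_one_right hR.le (pow_le_one₀ hθ0.le hθ1.le)
  set D := C₁ * (1 + R * κ) ^ (a / q) * V * C₂ * (V ^ (-(1 / q'))) ^ (1 - q' / p')
  have hD : 0 < D := by positivity
  -- Adding 1 keeps the constant positive even if `C₃ = 0`.
  refine ⟨D * ((C₃ : ℝ) + 1) ^ (1 / p'), by positivity, fun f hf hfc => ?_⟩
  obtain ⟨m, hm⟩ := hchain f hfc
  refine ⟨m, fun h hh N hN hX => ?_⟩
  set X := ∫⁻ y, h y ^ q'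
  set g : EuclideanSpace ℝ (Fin n) → ℝ≥0∞ := fun z => localEnergy Ω s p f z ^ (1 / p)
  have hE : Measurable (localEnergy Ω s p f) := measurable_localEnergy hf
  have hg : Measurable g := hE.pow_const _
  have hdc : Continuous (bdist Ω) := continuous_bdist
  set M := maximalFn volume ρ h
  have hM : Measurable M := measurable_maximalFn volume ρ hh
  -- The factor θ^(-jn) normalises the integral to an average, leaving θ^(js).
  have havg : ∀ z (j : ℕ), ENNReal.ofReal ((θ ^ j) ^ (s - n)) *
      ∫⁻ y in Metric.closedBall z (R * θ ^ j), h y = ENNReal.ofReal V *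
        (ENNReal.ofReal ((θ ^ j) ^ s) * ((volume (Metric.closedBall z (ρ j)))⁻¹ *
          ∫⁻ y in Metric.closedBall z (ρ j), h y)) := by
    intro z j
    have hj := hpow0 j
    simp only [ρ]
    rw [volume_closedBall_eq z (by positivity), ← mul_assoc, ← mul_assoc,
      ← ENNReal.ofReal_inv_of_pos (by positivity), ← ENNReal.ofReal_mul (by positivity),
      ← ENNReal.ofReal_mul (by positivity)]
    congr 2
    rw [Real.rpow_sub hj, Real.rpow_natCast]
    simp only [V, mul_pow]
    field_simp
  have hpoint : ∀ z ∈ Ω, (∑' j : ℕ, if θ ^ j ≤ κ * bdist Ω z then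
      ENNReal.ofReal ((θ ^ j) ^ (s - n)) * ∫⁻ y in Metric.closedBall z (R * θ ^ j), h y else 0) ≤
      ENNReal.ofReal (V * (C₂ * bdist Ω z ^ (s - α))) * (M z ^ (q' / p') *
        (ENNReal.ofReal (V ^ (-(1 / q'))) * X ^ (1 / q')) ^ (1 - q' / p')) := by
    intro z hz
    have h1 := hscale (bdist Ω z) (M z) (ENNReal.ofReal (V ^ (-(1 / q'))) * X ^ (1 / q'))
      (fun j => (volume (Metric.closedBall z (ρ j)))⁻¹ *
          ∫⁻ y in Metric.closedBall z (ρ j), h y) (hpos z hz)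
      ((maximalFn_le_const volume ρ hN z).trans_lt ENNReal.coe_lt_top).ne
      (ENNReal.mul_ne_top ENNReal.ofReal_ne_top (ENNReal.rpow_ne_top_of_nonneg (by positivity) hX))
      (fun j => le_iSup (fun j => (volume (Metric.closedBall z (ρ j)))⁻¹ *
          ∫⁻ y in Metric.closedBall z (ρ j), h y) j)
      (fun j => by
        refine (inv_volume_mul_setLIntegral_le hq.symm hh z (hρ0 j)).trans (le_of_eq ?_)
        have hj := hpow0 j
        have : (ρ j ^ n * unitBallVolume n) ^ (-(1 / q')) =
            V ^ (-(1 / q')) * (θ ^ j) ^ (-(n / q')) := by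
          have h2 : ρ j ^ n * unitBallVolume n = V * (θ ^ j) ^ (n : ℝ) := by
            simp only [ρ, V, mul_pow, Real.rpow_natCast]
            ring
          rw [h2, Real.mul_rpow hV.le (by positivity), ← Real.rpow_mul hj.le]
          congr 2
          field_simp
        rw [this, ENNReal.ofReal_mul (by positivity)]
        ring)
    rw [hratio, sub_sub_cancel] at h1
    rw [ENNReal.ofReal_mul hV.le, mul_assoc]
    refine le_trans ?_ (mul_le_mul_right h1 _)
    rw [← ENNReal.tsum_mul_left]
    refine ENNReal.tsum_le_tsum fun j => ?_
    split_ifs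
    · exact (havg z j).le
    · exact zero_le
  have hprod : ∀ z ∈ Ω, g z * (ENNReal.ofReal (((1 + R * κ) * bdist Ω z) ^ (a / q)) *
      ∑' j : ℕ, if θ ^ j ≤ κ * bdist Ω z then
        ENNReal.ofReal ((θ ^ j) ^ (s - n)) * ∫⁻ y in Metric.closedBall z (R * θ ^ j), h y
          else 0) ≤
      (ENNReal.ofReal ((1 + R * κ) ^ (a / q) * V * C₂ * (V ^ (-(1 / q'))) ^ (1 - q' / p')) *
        (X ^ (1 / q')) ^ (1 - q' / p')) *
        ((g z * ENNReal.ofReal (bdist Ω z ^ (b / p))) * M z ^ (q' / p')) := by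
    intro z hz
    have hdz := hpos z hz
    clear_value V
    have hbp : b / p = a / q + (s - α) := by rw [hb]; field_simp; ring
    calc _ ≤ g z * (ENNReal.ofReal (((1 + R * κ) * bdist Ω z) ^ (a / q)) *
          (ENNReal.ofReal (V * (C₂ * bdist Ω z ^ (s - α))) * (M z ^ (q' / p') *
          (ENNReal.ofReal (V ^ (-(1 / q'))) * X ^ (1 / q')) ^ (1 - q' / p')))) := by
          gcongr
          exact hpoint z hz
      _ = _ := by
          rw [ENNReal.mul_rpow_of_nonneg _ _ hratio0,
            ENNReal.ofReal_rpow_of_nonneg (by positivity) hratio0, hbp, Real.rpow_add hdz,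
            Real.mul_rpow (by positivity) hdz.le, ENNReal.ofReal_mul (by positivity),
            ENNReal.ofReal_mul (by positivity), ENNReal.ofReal_mul (by positivity),
            ENNReal.ofReal_mul (by positivity), ENNReal.ofReal_mul (by positivity),
            ENNReal.ofReal_mul (by positivity), ENNReal.ofReal_mul (by positivity)]
          ring
  have hHolder : ∫⁻ z in Ω, (g z * ENNReal.ofReal (bdist Ω z ^ (b / p))) * M z ^ (q' / p') ≤
      (∫⁻ z in Ω, localEnergy Ω s p f z * ENNReal.ofReal (bdist Ω z ^ b)) ^ (1 / p) *
        (ENNReal.ofReal (C₃ + 1) * X) ^ (1 / p') := by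
    have h1 := ENNReal.lintegral_mul_le_Lp_mul_Lq (volume.restrict Ω) hp
      (f := fun z => g z * ENNReal.ofReal (bdist Ω z ^ (b / p))) (g := fun z => M z ^ (q' / p'))
      (by fun_prop) (by fun_prop)
    refine h1.trans (mul_le_mul' (le_of_eq ?_) ?_)
    · congr 1
      refine setLIntegral_congr_fun hop.measurableSet fun z hz => ?_
      have hdz := hpos z hz
      simp only [g]
      rw [ENNReal.mul_rpow_of_nonneg _ _ hp0.le, ← ENNReal.rpow_mul, one_div_mul_cancel hp0.ne',
        ENNReal.rpow_one, ENNReal.ofReal_rpow_of_pos (by positivity), ← Real.rpow_mul hdz.le,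
        div_mul_cancel₀ _ hp0.ne']
    · gcongr
      calc ∫⁻ z in Ω, (M z ^ (q' / p')) ^ p' = ∫⁻ z in Ω, M z ^ q' := by
            simp_rw [← ENNReal.rpow_mul, div_mul_cancel₀ _ hp'0.ne']
        _ ≤ ∫⁻ z, M z ^ q' := setLIntegral_le_lintegral _ _
        _ ≤ C₃ * X := hmax ρ R hρ0 hρR h hh N hN
        _ ≤ ENNReal.ofReal (C₃ + 1) * X := by
            gcongr
            rw [← ENNReal.ofReal_coe_nnreal]
            exact ENNReal.ofReal_le_ofReal (by linarith)
  calc ∫⁻ y in Ω, h y * (ENNReal.ofReal (bdist Ω y ^ (a / q)) * ‖f y - m‖ₑ)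
      ≤ ∫⁻ y in Ω, ENNReal.ofReal C₁ * (h y * (ENNReal.ofReal (bdist Ω y ^ (a / q)) *
        ∑' j : ℕ, ENNReal.ofReal ((θ ^ j) ^ (s - n)) *
          ∫⁻ z in Ω ∩ {z | dist z y ≤ R * θ ^ j ∧ θ ^ j ≤ κ * bdist Ω z}, g z)) := by
        refine setLIntegral_mono' hop.measurableSet fun y hy => ?_
        rw [mul_left_comm (ENNReal.ofReal C₁), mul_left_comm (ENNReal.ofReal C₁)]
        gcongr
        exact hm y hy
    _ ≤ ENNReal.ofReal C₁ * ∫⁻ z in Ω, g z *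
        (ENNReal.ofReal (((1 + R * κ) * bdist Ω z) ^ (a / q)) *
        ∑' j : ℕ, if θ ^ j ≤ κ * bdist Ω z then ENNReal.ofReal ((θ ^ j) ^ (s - n)) *
          ∫⁻ y in Metric.closedBall z (R * θ ^ j), h y else 0) := by
        rw [lintegral_const_mul' _ _ ENNReal.ofReal_ne_top]
        exact mul_le_mul_right (lintegral_mul_tsum_scales_le hop hR (by positivity) hh hg _) _
    _ ≤ ENNReal.ofReal C₁ * ((ENNReal.ofReal ((1 + R * κ) ^ (a / q) * V * C₂ *
        (V ^ (-(1 / q'))) ^ (1 - q' / p')) * (X ^ (1 / q')) ^ (1 - q' / p')) *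
        ((∫⁻ z in Ω, localEnergy Ω s p f z * ENNReal.ofReal (bdist Ω z ^ b)) ^ (1 / p) *
        (ENNReal.ofReal (C₃ + 1) * X) ^ (1 / p'))) := by
        refine mul_le_mul_right ((setLIntegral_mono' hop.measurableSet hprod).trans ?_) _
        rw [lintegral_const_mul _ (by fun_prop)]
        exact mul_le_mul_right hHolder _
    _ = _ := by
        have hXexp : (X ^ (1 / q')) ^ (1 - q' / p') * X ^ (1 / p') = X ^ (1 / q') := by
          rw [← ENNReal.rpow_mul, ← ENNReal.rpow_add_of_nonneg _ _ (by positivity) (by positivity)]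
          congr 1
          field_simp
          ring
        have hDC : ENNReal.ofReal (D * (C₃ + 1) ^ (1 / p')) = ENNReal.ofReal C₁ *
            ENNReal.ofReal ((1 + R * κ) ^ (a / q) * V * C₂ *
              (V ^ (-(1 / q'))) ^ (1 - q' / p')) * ENNReal.ofReal ((C₃ + 1) ^ (1 / p')) := by
          rw [ENNReal.ofReal_mul hD.le, ← ENNReal.ofReal_mul hC₁.le]
          simp only [D, mul_assoc]
        rw [ENNReal.mul_rpow_of_nonneg _ _ (by positivity),
          ENNReal.ofReal_rpow_of_nonneg (by positivity) (by positivity), hDC]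
        nth_rw 2 [← hXexp]
        ring

end DualEstimate

/-! ### Weights, energies and the weighted inequality -/

section WeightedEstimates

variable {n : ℕ} {Ω : Set (EuclideanSpace ℝ (Fin n))}

/-- `Metric.infDist` to the empty set is 0 by convention, contradicting d ≥ lam > 0 at time 1. -/
lemma IsJohnDomain.nonempty_frontier (hΩ : IsJohnDomain Ω) : (frontier Ω).Nonempty := by
  obtain ⟨-, -, -, x₀, hx₀, γ, lam, hlam, K, -, C, -, hend, hmem, -, -⟩ := hΩ
  by_contra hempty
  have h1 := (hmem x₀ hx₀ 1 ⟨zero_le_one, le_rfl⟩).2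
  rw [bdist, Set.not_nonempty_iff_eq_empty.1 hempty, Metric.infDist_empty] at h1
  linarith

lemma IsJohnDomain.bdist_pos (hΩ : IsJohnDomain Ω) {x : EuclideanSpace ℝ (Fin n)} (hx : x ∈ Ω) :
    0 < bdist Ω x := by
  refine (isClosed_frontier.notMem_iff_infDist_pos hΩ.nonempty_frontier).1 fun hxf => ?_
  rw [hΩ.1.frontier_eq] at hxf
  exact hxf.2 hx

lemma IsJohnDomain.exists_bdist_le (hΩ : IsJohnDomain Ω) :
    ∃ D : ℝ, 0 < D ∧ ∀ x ∈ Ω, bdist Ω x ≤ D := by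
  obtain ⟨a, ha⟩ := hΩ.nonempty_frontier
  obtain ⟨D, hD⟩ := hΩ.2.2.1.subset_closedBall a
  exact ⟨max D 1, by positivity, fun x hx =>
    (Metric.infDist_le_dist_of_mem ha).trans ((hD hx).trans (le_max_left _ _))⟩

/-- The energy with weight `d(x)^b₀` is controlled by the energy with weight `δ(x, z)^b`. -/
lemma exists_lintegral_localEnergy_le (hΩ : IsJohnDomain Ω) (s p : ℝ) {b b₀ : ℝ} (hb : b ≤ b₀) :
    ∃ C : ℝ, 0 < C ∧ ∀ f : EuclideanSpace ℝ (Fin n) → ℝ,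
      ∫⁻ z in Ω, localEnergy Ω s p f z * ENNReal.ofReal (bdist Ω z ^ b₀) ≤
        ENNReal.ofReal C * fracEnergy Ω s p b f := by
  obtain ⟨D, hD, hDle⟩ := hΩ.exists_bdist_le
  refine ⟨D ^ (b₀ - b) * 2 ^ |b|, by positivity, fun f => ?_⟩
  rw [fracEnergy, ← lintegral_const_mul' _ _ ENNReal.ofReal_ne_top]
  refine setLIntegral_mono' hΩ.1.measurableSet fun z hz => ?_
  have hdz := hΩ.bdist_pos hz
  rw [localEnergy, ← lintegral_mul_const' _ _ ENNReal.ofReal_ne_top,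
    ← lintegral_const_mul' _ _ ENNReal.ofReal_ne_top]
  refine setLIntegral_mono' Metric.isClosed_closedBall.measurableSet fun w hw => ?_
  have hδ1 : bdist Ω z / 2 ≤ bdistMin Ω z w := by
    have h1 := bdist_le_add_dist (Ω := Ω) z w
    rw [Metric.mem_closedBall, dist_comm] at hw
    exact le_min (by linarith) (by linarith)
  have hδ2 : bdistMin Ω z w ≤ bdist Ω z := min_le_left _ _
  have hδ0 : 0 < bdistMin Ω z w := by linarith
  -- For b ≥ 0 use δ ≥ d(z)/2, for b ≤ 0 use δ ≤ d(z).
  have hpow : bdist Ω z ^ b ≤ 2 ^ |b| * bdistMin Ω z w ^ b := by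
    rcases le_total 0 b with h0 | h0
    · rw [abs_of_nonneg h0, ← Real.mul_rpow (by norm_num) hδ0.le]
      exact Real.rpow_le_rpow hdz.le (by linarith) h0
    · calc bdist Ω z ^ b ≤ bdistMin Ω z w ^ b := Real.rpow_le_rpow_of_nonpos hδ0 hδ2 h0
        _ ≤ _ := le_mul_of_one_le_left (by positivity)
          (Real.one_le_rpow (by norm_num) (abs_nonneg b))
  rw [← ENNReal.ofReal_mul (by positivity), ← ENNReal.ofReal_mul (by positivity)]
  refine ENNReal.ofReal_le_ofReal ?_
  have hb₀ : bdist Ω z ^ b₀ ≤ D ^ (b₀ - b) * 2 ^ |b| * bdistMin Ω z w ^ b := by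
    calc bdist Ω z ^ b₀ = bdist Ω z ^ (b₀ - b) * bdist Ω z ^ b := by
          rw [← Real.rpow_add hdz, sub_add_cancel]
      _ ≤ D ^ (b₀ - b) * (2 ^ |b| * bdistMin Ω z w ^ b) := by
          have := hDle z hz
          have : 0 ≤ b₀ - b := by linarith
          gcongr
      _ = _ := by ring
  calc _ ≤ |f w - f z| ^ p / ‖w - z‖ ^ ((n : ℝ) + s * p) *
        (D ^ (b₀ - b) * 2 ^ |b| * bdistMin Ω z w ^ b) := by gcongr
    _ = _ := by ring

lemma eLpNorm_weightedMeasure (hΩ : IsJohnDomain Ω) {q : ℝ} (hq : 0 < q) (a : ℝ)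
    {f : EuclideanSpace ℝ (Fin n) → ℝ} (hf : Measurable f) :
    eLpNorm f (ENNReal.ofReal q) (weightedMeasure Ω a) =
      (∫⁻ y in Ω, (ENNReal.ofReal (bdist Ω y ^ (a / q)) * ‖f y‖ₑ) ^ q) ^ (1 / q) := by
  have hd : Continuous (bdist Ω) := continuous_bdist
  rw [eLpNorm_eq_lintegral_rpow_enorm_toReal (by simpa using hq) ENNReal.ofReal_ne_top,
    ENNReal.toReal_ofReal hq.le, weightedMeasure,
    lintegral_withDensity_eq_lintegral_mul _ (by fun_prop) (by fun_prop)]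
  congr 1
  refine setLIntegral_congr_fun hΩ.1.measurableSet fun y hy => ?_
  have hdy := hΩ.bdist_pos hy
  simp only [Pi.mul_apply]
  rw [ENNReal.mul_rpow_of_nonneg _ _ hq.le, ENNReal.ofReal_rpow_of_pos (by positivity),
    ← Real.rpow_mul hdy.le, div_mul_cancel₀ _ hq.ne']

/-- The inner balls have radius d/2 and stay in Ω, so values outside Ω never enter. This allows
replacing `f` by its extension by zero. -/
lemma fracEnergy_congr (hΩ : IsOpen Ω) {s p b : ℝ} {f g : EuclideanSpace ℝ (Fin n) → ℝ}
    (hpos : ∀ x ∈ Ω, 0 < bdist Ω x) (hfg : Set.EqOn f g Ω) :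
    fracEnergy Ω s p b f = fracEnergy Ω s p b g := by
  refine setLIntegral_congr_fun hΩ.measurableSet fun z hz => ?_
  refine setLIntegral_congr_fun Metric.isClosed_closedBall.measurableSet fun w hw => ?_
  have hw' : w ∈ Ω := by
    refine mem_of_dist_lt_bdist hΩ hz ?_
    rw [Metric.mem_closedBall] at hw
    linarith [hpos z hz]
  simp only [hfg hz, hfg hw']

/-- The weighted fractional Poincaré inequality for measurable functions continuous on `Ω`. -/
lemma exists_eLpNorm_sub_le (hn : 0 < n) (hΩ : IsJohnDomain Ω) {s p q a b α : ℝ} (hs : 0 < s)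
    (hp : 1 < p) (hpq : p ≤ q) (ha : 0 ≤ a) (hα : α = n / p - n / q) (hαs : α ≤ s)
    (hb : b ≤ p * (a / q + s - α)) :
    ∃ C : ℝ, 0 < C ∧ ∀ f : EuclideanSpace ℝ (Fin n) → ℝ, Measurable f → ContinuousOn f Ω →
      ∃ m : ℝ, eLpNorm (fun x => f x - m) (ENNReal.ofReal q) (weightedMeasure Ω a) ≤
        ENNReal.ofReal C * fracEnergy Ω s p b f ^ (1 / p) := by
  have hp0 : 0 < p := by linarith
  have hq : 1 < q := by linarith
  have hq0 : 0 < q := by linarith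
  have hα0 : 0 ≤ α := by
    rw [hα, sub_nonneg]
    gcongr
  have hqq := Real.HolderConjugate.conjExponent hq
  obtain ⟨C₁, hC₁, hdual⟩ := exists_lintegral_mul_enorm_sub_le hn hΩ (fun _ => hΩ.bdist_pos) hs
    (Real.HolderConjugate.conjExponent hp) hqq ha hα hα0 hαs rfl
  obtain ⟨C₂, hC₂, henergy⟩ := exists_lintegral_localEnergy_le hΩ s p hb
  set q' := q.conjExponent
  have hq'0 : 0 < q' := hqq.symm.pos
  have hd : Continuous (bdist Ω) := continuous_bdist
  have hΩm : MeasurableSet Ω := hΩ.1.measurableSet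
  have hfin : IsFiniteMeasure (volume.restrict Ω) :=
    ⟨by rw [Measure.restrict_apply_univ]; exact hΩ.2.2.1.measure_lt_top⟩
  refine ⟨C₁ * C₂ ^ (1 / p), by positivity, fun f hf hfc => ?_⟩
  obtain ⟨m, hm⟩ := hdual f hf hfc
  refine ⟨m, ?_⟩
  rw [eLpNorm_weightedMeasure hΩ hq0 a (hf.sub_const m)]
  set u : EuclideanSpace ℝ (Fin n) → ℝ≥0∞ := fun y =>
    ENNReal.ofReal (bdist Ω y ^ (a / q)) * ‖f y - m‖ₑ
  have hu : Measurable u := by fun_prop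
  refine lintegral_rpow_le_of_truncation hu
    (fun x => ENNReal.mul_ne_top ENNReal.ofReal_ne_top enorm_ne_top) hq fun N => ?_
  -- The extremal test function of L^q duality, truncated to be bounded; since (q - 1)q' = q, its
  -- q'-th power is the truncated `u` to the q.
  set h : EuclideanSpace ℝ (Fin n) → ℝ≥0∞ := Ω.indicator fun y => min (u y) N ^ (q - 1)
  have hh : Measurable h := ((hu.min measurable_const).pow_const _).indicator hΩm
  have hhN : ∀ x, h x ≤ (((N : ℝ≥0) ^ (q - 1) : ℝ≥0) : ℝ≥0∞) := by
    intro x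
    refine (Set.indicator_le_self _ _ x).trans ?_
    rw [ENNReal.coe_rpow_of_nonneg _ (by linarith)]
    exact ENNReal.rpow_le_rpow (by simp) (by linarith)
  have hexp : (q - 1) * q' = q := mul_div_cancel₀ q (by linarith)
  have hhq : ∫⁻ y, h y ^ q' = ∫⁻ y in Ω, min (u y) N ^ q := by
    rw [← lintegral_indicator hΩm]
    congr 1 with y
    by_cases hy : y ∈ Ω
    · simp only [h, Set.indicator_of_mem hy]
      rw [← ENNReal.rpow_mul, hexp]
    · simp only [h, Set.indicator_of_notMem hy]
      exact ENNReal.zero_rpow_of_pos hq'0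
  have hX : ∫⁻ y, h y ^ q' ≠ ⊤ := by
    rw [hhq]
    refine ((lintegral_mono fun x => ENNReal.rpow_le_rpow (min_le_right _ _) hq0.le).trans_lt ?_).ne
    rw [lintegral_const]
    exact ENNReal.mul_lt_top (ENNReal.rpow_lt_top_of_nonneg hq0.le (ENNReal.natCast_ne_top N))
      (measure_lt_top _ _)
  have hmain := hm h hh _ hhN hX
  have hconj : 1 / q' = 1 - 1 / q := by
    have := hqq.inv_add_inv_eq_one
    rw [one_div, one_div]
    linarith
  rw [hhq, hconj] at hmain
  calc ∫⁻ y in Ω, min (u y) N ^ (q - 1) * u y = ∫⁻ y in Ω, h y * u y :=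
        setLIntegral_congr_fun hΩm fun y hy => by simp only [h, Set.indicator_of_mem hy]
    _ ≤ _ := hmain
    _ ≤ _ := by
        refine mul_le_mul_left ?_ _
        rw [ENNReal.ofReal_mul hC₁.le, mul_assoc,
          ← ENNReal.ofReal_rpow_of_pos hC₂, ← ENNReal.mul_rpow_of_nonneg _ _ (by positivity)]
        gcongr
        exact henergy f

end WeightedEstimates

end FracPoincare

/-! ### Main theorem -/

theorem mainTheorem1 (n : ℕ) (hn : 2 ≤ n) (Ω : Set (EuclideanSpace ℝ (Fin n)))
    (hΩ : FracPoincare.IsJohnDomain Ω) (s p q a b : ℝ) (hs0 : 0 < s) (hs1 : s < 1)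
    (hp : 1 < p) (hpq : p ≤ q) (ha : 0 ≤ a)
    (hb : b ≤ ((n : ℝ) + a) * p / q + s * p - n)
    (hq : p < (n : ℝ) / s → q ≤ (n : ℝ) * p / ((n : ℝ) - s * p)) :
    ∃ C : ℝ, 0 < C ∧ ∀ f : EuclideanSpace ℝ (Fin n) → ℝ, ContDiffOn ℝ ∞ f Ω →
      (⨅ c : ℝ, eLpNorm (fun x => f x - c) (ENNReal.ofReal q)
          (FracPoincare.weightedMeasure Ω a))
        ≤ ENNReal.ofReal C * FracPoincare.fracEnergy Ω s p b f ^ (1 / p) := by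
  have hn0 : (0 : ℝ) < n := by exact_mod_cast (by omega : 0 < n)
  have hp0 : 0 < p := by linarith
  have hq0 : 0 < q := by linarith
  -- For p < n/s this is the Sobolev bound on q rearranged; otherwise n/p ≤ s already.
  have hαs : (n : ℝ) / p - n / q ≤ s := by
    rcases lt_or_ge p (n / s) with h | h
    · have hsub : 0 < n - s * p := by
        rw [lt_div_iff₀ hs0] at h
        linarith
      have h1 := hq h
      rw [le_div_iff₀ hsub] at h1
      rw [div_sub_div _ _ hp0.ne' hq0.ne', div_le_iff₀ (by positivity)]
      linarith
    · have h1 : (n : ℝ) / p ≤ s := by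
        rw [div_le_iff₀ hs0] at h
        rw [div_le_iff₀ hp0]
        linarith
      have : 0 < (n : ℝ) / q := by positivity
      linarith
  have hb' : b ≤ p * (a / q + s - (n / p - n / q)) := by
    refine hb.trans (le_of_eq ?_)
    field_simp
    ring
  obtain ⟨C, hC, hmain⟩ := FracPoincare.exists_eLpNorm_sub_le (by omega) hΩ hs0 hp hpq ha rfl hαs hb'
  refine ⟨C, hC, fun f hf => ?_⟩
  have hΩm : MeasurableSet Ω := hΩ.1.measurableSet
  have heq : Set.EqOn f (Ω.indicator f) Ω := fun x hx => (Set.indicator_of_mem hx f).symm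
  classical
  -- `f` is controlled only on Ω; extending it by zero gives global measurability and changes
  -- neither side.
  have hmeas : Measurable (Ω.indicator f) := by
    rw [← Set.piecewise_eq_indicator]
    exact hf.continuousOn.measurable_piecewise continuousOn_const hΩm
  obtain ⟨m, hm⟩ := hmain _ hmeas (hf.continuousOn.congr heq.symm)
  refine (iInf_le _ m).trans ?_
  rw [FracPoincare.fracEnergy_congr hΩ.1 (fun _ => hΩ.bdist_pos) heq]
  refine (le_of_eq (eLpNorm_congr_ae ?_)).trans hm
  refine (withDensity_absolutelyContinuous _ _).ae_le ?_
  filter_upwards [ae_restrict_mem hΩm] with x hx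
  rw [heq hx]
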